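/- Let $S_n$ be the group of permutations of $[n]=\{1,\dots,n\}$. Two permutations $\sigma,\tau\in S_n$ \emph{intersect} if $\sigma(k)=\tau(k)$ for some $k\in[n]$; families $\mathcal{A},\mathcal{B}\subset S_n$ are \emph{cross-intersecting} if every $\sigma\in\mathcal{A}$ intersects every $\tau\in\mathcal{B}$. A \emph{1-coset} is a set $\{\sigma\in S_n:\sigma(i)=j\}$ with $i,j\in[n]$. Let $d_m$ be the number of permutations of an $m$-element set without fixed points, and let $$\mathcal{C}=\{\sigma\in S_n:\ \sigma(1)=1,\ \sigma\text{ intersects }(1\ 2)\}\cup\{(1\ 2)\}.$$ There is an $N\geq 2$ such that the following holds for all $n\ge N$. If $\mathcal{A},\mathcal{B}\subset S_n$ are cross-intersecting and are not both contained within the same 1-coset, then $$\min(|\mathcal{A}|,|\mathcal{B}|)\ \le\ |\mathcal{C}|=(n-1)!-d_{n-1}-d_{n-2}+1,$$ with equality if and only if $$\mathcal{A}=\{\sigma\in S_n:\sigma(i)=j,\ \sigma\text{ intersects }\tau\}\cup\{\rho\},\qquad \mathcal{B}=\{\sigma\in S_n:\sigma(i)=j,\ \sigma\text{ intersects }\rho\}\cup\{\tau\}$$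 for some $i,j\in[n]$ and some $\tau,\rho\in S_n$ which intersect and satisfy $\tau(i)\ne j$, $\rho(i)\neq j$. -/

import Mathlib

namespace CrossInt

/-- Two permutations of `[n]` intersect if they agree at some point. -/
def Intersects {n : ℕ} (σ τ : Equiv.Perm (Fin n)) : Prop :=
  ∃ k, σ k = τ k

instance {n : ℕ} (σ τ : Equiv.Perm (Fin n)) : Decidable (Intersects σ τ) :=
  inferInstanceAs (Decidable (∃ k, σ k = τ k))

/-- A pair of families is cross-intersecting if every member of the first intersects every
member of the second. -/
def CrossIntersecting {n : ℕ} (A B : Finset (Equiv.Perm (Fin n))) : Prop :=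
  ∀ σ ∈ A, ∀ τ ∈ B, Intersects σ τ

/-- The 1-coset of all permutations mapping `i` to `j`. -/
def oneCoset {n : ℕ} (i j : Fin n) : Finset (Equiv.Perm (Fin n)) :=
  {σ | σ i = j}

/-- The permutations that map `i` to `j` and intersect `τ`. -/
def cosetMeeting {n : ℕ} (i j : Fin n) (τ : Equiv.Perm (Fin n)) :
    Finset (Equiv.Perm (Fin n)) :=
  {σ | σ i = j ∧ Intersects σ τ}

/-- The family `{σ : σ(1) = 1, σ intersects (1 2)} ∪ {(1 2)}`. The points `1`, `2` of `[n]` are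
`0`, `1` in `Fin n`. -/
def familyC (n : ℕ) (h : 2 ≤ n) : Finset (Equiv.Perm (Fin n)) :=
  cosetMeeting ⟨0, by omega⟩ ⟨0, by omega⟩ (Equiv.swap ⟨0, by omega⟩ ⟨1, by omega⟩) ∪
    {Equiv.swap ⟨0, by omega⟩ ⟨1, by omega⟩}

end CrossInt

namespace CrossInt
open Finset

/-! It suffices to treat families that both have at least |C| members and show that they have the
extremal form: both members of an extremal pair have exactly |C| elements, so this yields the bound
and the equality case together.

Stability. View permutations as n-element sets of pairs (k, σ k), and let r = n/6. A largest set X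
contained in exceptionally many members of a family has an r-spread link, so all but (n-1)!/100
members of each family contain a core of logarithmic size at most q (`card_without_core_le`). Two
spread families have disjoint members (`exists_disjoint_of_spread`): colour the points at random in
two rounds and count minimal fragments (`sum_pow_card_residual_le`). Hence small cores of A meet
small cores of B. Unless all these cores share one pair, the small cores of one family each contain
one of at most q² fixed two-element sets, which makes that family too small. So both families lie in
a common 1-coset up to (n-1)!/100 members (`exists_oneCoset_almost_containing`).

Bootstrapping. Let π, τ ∈ B lie outside this coset. Inside the coset, A must meet π and loses
everything meeting π but not τ. If π and τ agree at fewer than n/10 points, a second-moment bound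
(`card_cosetSeparating_ge`) makes this loss larger than A's part outside the coset, so |A| < |C|.
Hence B's exceptional members all agree substantially with any one of them, which leaves at most
d_{n-2}; likewise for A. But distinct π and τ always cost A at least d_{n-2}, so each family has at
most one exceptional member. Neither can have none, and the sizes then force the form
(`extremal_form`). -/

/-- The points of colour `γ`. -/
def colourClass {V C : Type*} [Fintype V] [DecidableEq C] (γ : C) (c : V → C) :
    Finset V :=
  univ.filter fun v => c v = γ

@[simp]
theorem mem_colourClass {V C : Type*} [Fintype V] [DecidableEq C] {γ : C} {c : V → C} {v : V} :
    v ∈ colourClass γ c ↔ c v = γ := by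
  simp [colourClass]

/-! ### Minimal fragments relative to a random colour class. -/

section Residual

variable {V ι : Type*} [DecidableEq V] [Fintype ι]

theorem exists_residual (S : ι → Finset V) (W : Finset V) (i : ι) :
    ∃ Z : Finset V, (∃ j, Z = S j \ W) ∧ Z ⊆ S i ∧
      ∀ l, S l ⊆ W ∪ S i → Z.card ≤ (S l \ W).card := by
  classical
  obtain ⟨j, hj, hmin⟩ := exists_min_image (univ.filter fun j => S j ⊆ W ∪ S i)
    (fun j => (S j \ W).card) ⟨i, by simp⟩
  refine ⟨S j \ W, ⟨j, rfl⟩, ?_, fun l hl => hmin l (by simpa using hl)⟩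
  exact sdiff_le_iff.2 (by simpa using hj)

/-- The smallest set `S j \ W` among the members `S j` contained in `W ∪ S i`. -/
noncomputable def residual (S : ι → Finset V) (W : Finset V) (i : ι) : Finset V :=
  (exists_residual S W i).choose

theorem residual_eq (S : ι → Finset V) (W : Finset V) (i : ι) :
    ∃ j, residual S W i = S j \ W :=
  (exists_residual S W i).choose_spec.1

theorem residual_subset (S : ι → Finset V) (W : Finset V) (i : ι) : residual S W i ⊆ S i :=
  (exists_residual S W i).choose_spec.2.1

theorem card_residual_le (S : ι → Finset V) (W : Finset V) (i l : ι) (h : S l ⊆ W ∪ S i) :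
    (residual S W i).card ≤ (S l \ W).card :=
  (exists_residual S W i).choose_spec.2.2 l h

/-- Such an S l competes in the minimum defining the residual, and S l \ W already lies in the
residual, so the two coincide. Thus any member found inside W ∪ Z contains the fragment Z, and Z can
be recovered as one of its subsets. -/
theorem residual_subset_of_subset (S : ι → Finset V) (W : Finset V) (i l : ι)
    (h : S l ⊆ W ∪ residual S W i) : residual S W i ⊆ S l := by
  have h1 : S l \ W ⊆ residual S W i := sdiff_le_iff.2 h
  have h2 := card_residual_le S W i l
    (h.trans (union_subset_union_right (residual_subset S W i)))
  rw [← eq_of_subset_of_card_le h1 h2]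
  exact sdiff_subset

variable [Fintype V] {C : Type*} [Fintype C] [DecidableEq C]

/-- If members of the family `S` rarely contain a given set, then the residuals with respect to a
random colour class are small on average. -/
theorem sum_pow_card_residual_le (S : ι → Finset V) (γ : C) {k : ℕ} (hk : ∀ i, (S i).card ≤ k)
    {M ρ θ : ℝ} (hM : 0 ≤ M) (hρ : 0 ≤ ρ) (hθ : 0 ≤ θ)
    (hS : ∀ Y : Finset V, ((univ.filter fun i => Y ⊆ S i).card : ℝ) ≤ M * ρ ^ Y.card) :
    ∑ c : V → C, ∑ i, θ ^ (residual S (colourClass γ c) i).card ≤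
      (Fintype.card C : ℝ) ^ Fintype.card V * M *
        (1 + θ * ((Fintype.card C - 1 : ℕ) : ℝ) * ρ) ^ k := by
  classical
  -- This member depends only on the colouring. For the recoloured c' below it contains the
  -- fragment, leaving at most 2^k candidates for Z.
  let L : (V → C) → Finset V := fun c =>
    if h : ∃ l, S l ⊆ colourClass γ c then S h.choose else ∅
  have hL : ∀ c, (L c).card ≤ k := by
    intro c
    by_cases h : ∃ l, S l ⊆ colourClass γ c
    · simp only [L, dif_pos h]; exact hk _
    · simp [L, dif_neg h]
  -- The possible original colourings, given the recoloured one and the fragment Z: on Z any colour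
  -- but γ was possible, elsewhere nothing changed.
  let Q : (V → C) → Finset V → Finset (V → C) := fun c Z =>
    Fintype.piFinset fun v => if v ∈ Z then univ.erase γ else {c v}
  have hQ : ∀ c Z, (Q c Z).card = (Fintype.card C - 1) ^ Z.card := by
    intro c Z
    simp only [Q, Fintype.card_piFinset]
    rw [← prod_filter_mul_prod_filter_not univ (· ∈ Z)]
    rw [prod_congr rfl (g := fun _ => Fintype.card C - 1), prod_congr (s₁ := univ.filter (· ∉ Z)) rfl
      (g := fun _ => 1)]
    · simp
    · intro v hv
      simp only [mem_filter, mem_univ, true_and] at hv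
      simp [hv]
    · intro v hv
      simp only [mem_filter, mem_univ, true_and] at hv
      simp [hv, card_erase_of_mem]
  have key : ∀ (c : V → C) (i : ι), θ ^ (residual S (colourClass γ c) i).card ≤
      ∑ c' : V → C, ∑ Z ∈ (L c').powerset, if c ∈ Q c' Z ∧ Z ⊆ S i then θ ^ Z.card else 0 := by
    intro c i
    set Z := residual S (colourClass γ c) i with hZ
    let c' : V → C := fun v => if v ∈ Z then γ else c v
    obtain ⟨j, hj⟩ := residual_eq S (colourClass γ c) i
    have hdisj : ∀ v ∈ Z, c v ≠ γ := by
      intro v hv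
      rw [hZ, hj] at hv
      simpa using (mem_sdiff.1 hv).2
    have hc' : colourClass γ c' = colourClass γ c ∪ Z := by
      ext v
      by_cases hv : v ∈ Z <;> simp [c', hv]
    have hex : ∃ l, S l ⊆ colourClass γ c' := by
      refine ⟨j, ?_⟩
      rw [hc', hZ, hj]
      intro v hv
      by_cases h : v ∈ colourClass γ c <;> simp_all
    have hZL : Z ∈ (L c').powerset := by
      rw [mem_powerset]
      simp only [L, dif_pos hex]
      exact residual_subset_of_subset S _ i _ (hc' ▸ hex.choose_spec)
    have hcQ : c ∈ Q c' Z := by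
      simp only [Q, Fintype.mem_piFinset]
      intro v
      by_cases hv : v ∈ Z
      · simp [hv, hdisj v hv]
      · simp [hv, c']
    have hnn : ∀ c' : V → C, ∀ Z : Finset V,
        0 ≤ if c ∈ Q c' Z ∧ Z ⊆ S i then θ ^ Z.card else 0 := by
      intro c' Z
      split_ifs
      · positivity
      · exact le_rfl
    calc θ ^ Z.card = if c ∈ Q c' Z ∧ Z ⊆ S i then θ ^ Z.card else 0 := by
            rw [if_pos ⟨hcQ, residual_subset S _ i⟩]
      _ ≤ ∑ Z ∈ (L c').powerset, if c ∈ Q c' Z ∧ Z ⊆ S i then θ ^ Z.card else 0 :=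
            single_le_sum (f := fun Z => if c ∈ Q c' Z ∧ Z ⊆ S i then θ ^ Z.card else 0)
              (fun Z _ => hnn c' Z) hZL
      _ ≤ _ := single_le_sum (f := fun c' => ∑ Z ∈ (L c').powerset,
              if c ∈ Q c' Z ∧ Z ⊆ S i then θ ^ Z.card else 0)
              (fun c' _ => sum_nonneg fun Z _ => hnn c' Z) (mem_univ c')
  have inner : ∀ (c' : V → C) (Z : Finset V),
      ∑ c : V → C, ∑ i, (if c ∈ Q c' Z ∧ Z ⊆ S i then θ ^ Z.card else 0) ≤
        M * (θ * ((Fintype.card C - 1 : ℕ) : ℝ) * ρ) ^ Z.card := by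
    intro c' Z
    have : ∑ c : V → C, ∑ i, (if c ∈ Q c' Z ∧ Z ⊆ S i then θ ^ Z.card else 0) =
        (Q c' Z).card * ((univ.filter fun i => Z ⊆ S i).card * θ ^ Z.card) := by
      simp only [ite_and]
      simp [← sum_filter]
    rw [this, hQ]
    push_cast
    calc ((Fintype.card C - 1 : ℕ) : ℝ) ^ Z.card *
          ((univ.filter fun i => Z ⊆ S i).card * θ ^ Z.card)
        ≤ ((Fintype.card C - 1 : ℕ) : ℝ) ^ Z.card * ((M * ρ ^ Z.card) * θ ^ Z.card) := by
          gcongr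
          exact hS Z
      _ = _ := by rw [mul_pow, mul_pow]; ring
  set a := θ * ((Fintype.card C - 1 : ℕ) : ℝ) * ρ with ha
  have ha0 : 0 ≤ a := by positivity
  calc ∑ c : V → C, ∑ i, θ ^ (residual S (colourClass γ c) i).card
      ≤ ∑ c : V → C, ∑ i, ∑ c' : V → C, ∑ Z ∈ (L c').powerset,
          (if c ∈ Q c' Z ∧ Z ⊆ S i then θ ^ Z.card else 0) :=
        sum_le_sum fun c _ => sum_le_sum fun i _ => key c i
    _ = ∑ c' : V → C, ∑ Z ∈ (L c').powerset, ∑ c : V → C, ∑ i,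
          (if c ∈ Q c' Z ∧ Z ⊆ S i then θ ^ Z.card else 0) := by
        simp_rw [sum_comm (s := (univ : Finset ι)) (t := (univ : Finset (V → C)))]
        rw [sum_comm]
        refine sum_congr rfl fun c' _ => ?_
        simp_rw [sum_comm (s := (univ : Finset ι)) (t := (L c').powerset)]
        rw [sum_comm]
    _ ≤ ∑ c' : V → C, ∑ Z ∈ (L c').powerset, M * a ^ Z.card :=
        sum_le_sum fun c' _ => sum_le_sum fun Z _ => inner c' Z
    _ = ∑ c' : V → C, M * (a + 1) ^ (L c').card := by
        refine sum_congr rfl fun c' _ => ?_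
        -- Binomial theorem over all candidate fragments inside `L c'`.
        rw [← mul_sum, ← sum_pow_mul_eq_add_pow]
        simp
    _ ≤ ∑ c' : V → C, M * (a + 1) ^ k := by
        refine sum_le_sum fun c' _ => ?_
        gcongr
        · linarith
        · exact hL c'
    _ = _ := by
        simp only [sum_const, card_univ, Fintype.card_fun, nsmul_eq_mul]
        push_cast
        ring

end Residual

/-! ### Two-round colouring and disjoint members of spread families. -/

section Cover

variable {V ι : Type*} [DecidableEq V] [Fintype V] [Fintype ι]

/-- Keep the first colour if it is `0`, and otherwise use the second one, shifted by one. -/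
def recolour (p : Fin 4 × Fin 3) : Fin 4 := if p.1 = 0 then 0 else p.2.succ

/-- Every colour in `Fin 4` has exactly three preimages under `recolour`, so exposing the colouring
in two rounds still gives a uniform colouring. -/
theorem card_recolour_fibre (P : (V → Fin 4) → Prop) [DecidablePred P] :
    (univ.filter fun c : V → Fin 4 × Fin 3 => P fun v => recolour (c v)).card =
      (univ.filter P).card * 3 ^ Fintype.card V := by
  classical
  rw [card_eq_sum_card_fiberwise (f := fun c v => recolour (c v)) (t := univ.filter P)]
  · rw [sum_const_nat (m := 3 ^ Fintype.card V)]
    intro c hc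
    rw [mem_filter] at hc
    have : (univ.filter fun d : V → Fin 4 × Fin 3 => P fun v => recolour (d v)).filter
        (fun d => (fun v => recolour (d v)) = c) =
        Fintype.piFinset fun v => univ.filter fun x => recolour x = c v := by
      ext d
      simp only [mem_filter, mem_univ, true_and, Fintype.mem_piFinset]
      constructor
      · rintro ⟨-, h⟩ v
        exact congrFun h v
      · intro h
        have : (fun v => recolour (d v)) = c := funext h
        exact ⟨this ▸ hc.2, this⟩
    rw [this, Fintype.card_piFinset]
    have h3 : ∀ x : Fin 4, (univ.filter fun y => recolour y = x).card = 3 := by decide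
    simp [h3]
  · intro c hc
    simpa using hc

theorem card_filter_pair (P : (V → Fin 4) → (V → Fin 3) → Prop) [∀ c d, Decidable (P c d)] :
    (univ.filter fun c : V → Fin 4 × Fin 3 => P (fun v => (c v).1) (fun v => (c v).2)).card =
      ∑ c : V → Fin 4, (univ.filter fun d => P c d).card := by
  classical
  rw [← card_sigma]
  refine card_bij' (fun c _ => ⟨fun v => (c v).1, fun v => (c v).2⟩)
    (fun p _ v => (p.1 v, p.2 v)) ?_ ?_ ?_ ?_ <;> simp

/-- Most colourings of the points by four colours have a member of the spread family `S` inside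
the first two colour classes. -/
theorem card_colourings_without_member_lt [Nonempty ι] (S : ι → Finset V) {k m : ℕ}
    (hk : ∀ i, (S i).card ≤ k) {ρ : ℝ} (hρ : 0 ≤ ρ)
    (hS : ∀ Y : Finset V,
      ((univ.filter fun i => Y ⊆ S i).card : ℝ) ≤ 2 * Fintype.card ι * ρ ^ Y.card)
    (h1 : 16 * (1 + 6 * ρ) ^ k ≤ 2 ^ m) (h2 : (1 + 128 * ρ) ^ m ≤ 2) :
    2 * (univ.filter fun c : V → Fin 4 =>
      ¬ ∃ i, ∀ v ∈ S i, c v = 0 ∨ c v = 1).card < 4 ^ Fintype.card V := by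
  classical
  set N := Fintype.card V
  set I : ℝ := ((Fintype.card ι : ℕ) : ℝ) with hI
  have hIpos : 0 < I := by
    rw [hI]
    exact_mod_cast Fintype.card_pos
  -- indices with small residual after the first round
  let G : (V → Fin 4) → Finset ι := fun c =>
    univ.filter fun i => (residual S (colourClass 0 c) i).card < m
  let bad : Finset (V → Fin 4) := univ.filter fun c => 2 * (G c).card < Fintype.card ι
  have round1 : (bad.card : ℝ) * 4 ≤ 4 ^ N := by
    -- Markov's inequality: a bad colouring contributes at least (I/2)·2^m, while the total is at
    -- most 4^N·2I·2^m/16, so at most a quarter of the colourings are bad.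
    have h := sum_pow_card_residual_le (C := Fin 4) S 0 hk (M := 2 * I) (ρ := ρ) (θ := 2)
      (by positivity) hρ (by norm_num) hS
    have hlow : (bad.card : ℝ) * (I / 2 * 2 ^ m) ≤
        ∑ c : V → Fin 4, ∑ i, (2 : ℝ) ^ (residual S (colourClass 0 c) i).card := by
      calc (bad.card : ℝ) * (I / 2 * 2 ^ m) = ∑ c ∈ bad, I / 2 * 2 ^ m := by simp
        _ ≤ ∑ c ∈ bad, ∑ i, (2 : ℝ) ^ (residual S (colourClass 0 c) i).card := by
            refine sum_le_sum fun c hc => ?_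
            have hc' : 2 * (G c).card < Fintype.card ι := by simpa [bad] using hc
            have hcompl : (univ.filter fun i => ¬ (residual S (colourClass 0 c) i).card < m).card
                + (G c).card = Fintype.card ι := by
              rw [add_comm, card_filter_add_card_filter_not, card_univ]
            have hge : I / 2 ≤
                ((univ.filter fun i => ¬ (residual S (colourClass 0 c) i).card < m).card : ℝ) := by
              rw [hI, ← hcompl]
              have : (G c).card ≤
                (univ.filter fun i => ¬ (residual S (colourClass 0 c) i).card < m).card := by omega
              have : ((G c).card : ℝ) ≤
                (univ.filter fun i => ¬ (residual S (colourClass 0 c) i).card < m).card := by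
                exact_mod_cast this
              push_cast
              linarith
            calc I / 2 * 2 ^ m ≤ ((univ.filter fun i =>
                  ¬ (residual S (colourClass 0 c) i).card < m).card : ℝ) * 2 ^ m := by gcongr
              _ = ∑ i ∈ univ.filter fun i => ¬ (residual S (colourClass 0 c) i).card < m,
                    (2 : ℝ) ^ m := by simp
              _ ≤ ∑ i ∈ univ.filter fun i => ¬ (residual S (colourClass 0 c) i).card < m,
                    (2 : ℝ) ^ (residual S (colourClass 0 c) i).card := by
                  refine sum_le_sum fun i hi => ?_
                  have := (mem_filter.1 hi).2
                  exact pow_le_pow_right₀ (by norm_num) (by omega)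
              _ ≤ _ := sum_le_univ_sum_of_nonneg fun i => by positivity
        _ ≤ _ := sum_le_univ_sum_of_nonneg fun c => sum_nonneg fun i _ => by positivity
    have hup := hlow.trans h
    simp only [Fintype.card_fin, Nat.add_one_sub_one] at hup
    norm_num at hup
    have h1' : (4 : ℝ) ^ N * (2 * I) * (1 + 6 * ρ) ^ k ≤ 4 ^ N * (2 * I) * (2 ^ m / 16) := by
      gcongr
      linarith
    have h3 := hup.trans h1'
    have hpos : 0 < I * 2 ^ m := by positivity
    have h4 : (bad.card : ℝ) * 4 * (I * 2 ^ m) ≤ 4 ^ N * (I * 2 ^ m) := by linarith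
    exact le_of_mul_le_mul_right h4 hpos
  -- second round: colour `0` of `Fin 3` becomes colour `1`
  let fails : (V → Fin 4) → Finset (V → Fin 3) := fun c => univ.filter fun d =>
    ¬ ∃ i, ∀ v ∈ S i, recolour (c v, d v) = 0 ∨ recolour (c v, d v) = 1
  have round2 : ∀ c, c ∉ bad → ((fails c).card : ℝ) * 8 ≤ 3 ^ N := by
    intro c hc
    have hG : I ≤ 2 * (G c).card := by
      have : ¬ 2 * (G c).card < Fintype.card ι := by simpa [bad] using hc
      rw [hI]
      exact_mod_cast not_lt.1 this
    let T : G c → Finset V := fun i => residual S (colourClass 0 c) i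
    have hT : ∀ Y : Finset V,
        ((univ.filter fun i => Y ⊆ T i).card : ℝ) ≤ 2 * I * ρ ^ Y.card := by
      intro Y
      refine le_trans ?_ (hS Y)
      norm_cast
      refine card_le_card_of_injOn (fun i => (i : ι)) ?_ Subtype.val_injective.injOn
      intro i hi
      have hi' : Y ⊆ T i := by simpa using hi
      simpa using hi'.trans (residual_subset S _ _)
    -- On failure every residual is nonempty, so each of the at least I/2 indices contributes at
    -- least θ = 64. The total is at most 3^N·4I, so at most one eighth fail.
    have h := sum_pow_card_residual_le (C := Fin 3) T 0 (k := m)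
      (fun i => (mem_filter.1 i.2).2.le) (M := 2 * I) (ρ := ρ) (θ := 64)
      (by positivity) hρ (by norm_num) hT
    have hlow : ((fails c).card : ℝ) * ((G c).card * 64) ≤
        ∑ d : V → Fin 3, ∑ i, (64 : ℝ) ^ (residual T (colourClass 0 d) i).card := by
      calc ((fails c).card : ℝ) * ((G c).card * 64)
          = ∑ d ∈ fails c, ((G c).card * 64 : ℝ) := by simp
        _ ≤ ∑ d ∈ fails c, ∑ i, (64 : ℝ) ^ (residual T (colourClass 0 d) i).card := by
            refine sum_le_sum fun d hd => ?_
            have hd' : ¬ ∃ i, ∀ v ∈ S i, recolour (c v, d v) = 0 ∨ recolour (c v, d v) = 1 := by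
              simpa [fails] using hd
            calc ((G c).card * 64 : ℝ) = ∑ i : G c, (64 : ℝ) ^ 1 := by simp
              _ ≤ _ := by
                refine sum_le_sum fun i _ => pow_le_pow_right₀ (by norm_num) ?_
                by_contra hlt
                have h0 : residual T (colourClass 0 d) i = ∅ := by
                  rw [← card_eq_zero]; omega
                obtain ⟨j, hj⟩ := residual_eq T (colourClass 0 d) i
                rw [h0] at hj
                have hj' : T j ⊆ colourClass 0 d := sdiff_eq_empty_iff_subset.1 hj.symm
                obtain ⟨l, hl⟩ := residual_eq S (colourClass 0 c) j
                refine hd' ⟨l, fun v hv => ?_⟩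
                by_cases hcv : c v = 0
                · left; simp [recolour, hcv]
                · right
                  have : v ∈ T j := by
                    simp only [T, hl]
                    simp [hv, hcv]
                  have hdv : d v = 0 := by simpa using hj' this
                  simp [recolour, hcv, hdv]
        _ ≤ _ := sum_le_univ_sum_of_nonneg fun c => sum_nonneg fun i _ => by positivity
    have hup := hlow.trans h
    simp only [Fintype.card_fin, Nat.add_one_sub_one] at hup
    norm_num at hup
    have h1' : (3 : ℝ) ^ N * (2 * I) * (1 + 128 * ρ) ^ m ≤ 3 ^ N * (2 * I) * 2 := by
      gcongr
    have h2' : ((fails c).card : ℝ) * (I / 2 * 64) ≤ (fails c).card * ((G c).card * 64) := by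
      gcongr
      linarith
    have h4 : ((fails c).card : ℝ) * 8 * I ≤ 3 ^ N * I := by linarith
    exact le_of_mul_le_mul_right h4 hIpos
  have hcount := card_recolour_fibre (V := V) fun c => ¬ ∃ i, ∀ v ∈ S i, c v = 0 ∨ c v = 1
  have hpair := card_filter_pair (V := V) fun c d =>
    ¬ ∃ i, ∀ v ∈ S i, recolour (c v, d v) = 0 ∨ recolour (c v, d v) = 1
  have htot := hcount.symm.trans hpair
  have hsum : ((∑ c : V → Fin 4, (fails c).card : ℕ) : ℝ) ≤ 3 ^ N * bad.card + 4 ^ N * (3 ^ N / 8) := by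
    push_cast
    rw [← sum_filter_add_sum_filter_not univ (· ∈ bad)]
    refine add_le_add ?_ ?_
    · calc ∑ c ∈ univ.filter (· ∈ bad), ((fails c).card : ℝ)
          ≤ ∑ c ∈ univ.filter (· ∈ bad), (3 : ℝ) ^ N := by
            refine sum_le_sum fun c _ => ?_
            have := card_le_univ (fails c)
            simp only [Fintype.card_fun, Fintype.card_fin] at this
            exact_mod_cast this
        _ = _ := by simp [mul_comm]
    · calc ∑ c ∈ univ.filter (· ∉ bad), ((fails c).card : ℝ)
          ≤ ∑ c ∈ univ.filter (· ∉ bad), (3 : ℝ) ^ N / 8 := by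
            refine sum_le_sum fun c hc => ?_
            have := round2 c (mem_filter.1 hc).2
            linarith
        _ ≤ ∑ c : V → Fin 4, (3 : ℝ) ^ N / 8 := sum_le_univ_sum_of_nonneg fun c => by positivity
        _ = _ := by simp [N]
  have hfin : ((univ.filter fun c : V → Fin 4 =>
      ¬ ∃ i, ∀ v ∈ S i, c v = 0 ∨ c v = 1).card : ℝ) * 3 ^ N ≤
      3 ^ N * bad.card + 4 ^ N * (3 ^ N / 8) := by
    refine le_trans (le_of_eq ?_) hsum
    exact_mod_cast htot
  have h3 : (0 : ℝ) < 3 ^ N := by positivity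
  have h4 : (0 : ℝ) < 4 ^ N := by positivity
  have hfin' : ((univ.filter fun c : V → Fin 4 =>
      ¬ ∃ i, ∀ v ∈ S i, c v = 0 ∨ c v = 1).card : ℝ) ≤ bad.card + 4 ^ N / 8 := by
    refine le_of_mul_le_mul_right ?_ h3
    linarith
  -- The failure proportions add up to at most 1/4 + 1/8 < 1/2.
  have : (2 : ℝ) * ((univ.filter fun c : V → Fin 4 =>
      ¬ ∃ i, ∀ v ∈ S i, c v = 0 ∨ c v = 1).card : ℝ) < 4 ^ N := by linarith
  exact_mod_cast this

/-- Two spread families have disjoint members. -/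
theorem exists_disjoint_of_spread {κ : Type*} [Fintype κ] [Nonempty ι] [Nonempty κ]
    (S : ι → Finset V) (T : κ → Finset V) {k m : ℕ}
    (hSk : ∀ i, (S i).card ≤ k) (hTk : ∀ i, (T i).card ≤ k) {ρ : ℝ} (hρ : 0 ≤ ρ)
    (hS : ∀ Y : Finset V,
      ((univ.filter fun i => Y ⊆ S i).card : ℝ) ≤ 2 * Fintype.card ι * ρ ^ Y.card)
    (hT : ∀ Y : Finset V,
      ((univ.filter fun i => Y ⊆ T i).card : ℝ) ≤ 2 * Fintype.card κ * ρ ^ Y.card)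
    (h1 : 16 * (1 + 6 * ρ) ^ k ≤ 2 ^ m) (h2 : (1 + 128 * ρ) ^ m ≤ 2) :
    ∃ i j, Disjoint (S i) (T j) := by
  classical
  have hA := card_colourings_without_member_lt S hSk hρ hS h1 h2
  have hB := card_colourings_without_member_lt T hTk hρ hT h1 h2
  -- Reversing the colours reserves {2, 3} for T while S uses {0, 1}; each side fails for fewer than
  -- half of the colourings, so some colouring serves both.
  have hB' : (univ.filter fun c : V → Fin 4 =>
      ¬ ∃ i, ∀ v ∈ T i, (c v).rev = 0 ∨ (c v).rev = 1).card =
      (univ.filter fun c : V → Fin 4 => ¬ ∃ i, ∀ v ∈ T i, c v = 0 ∨ c v = 1).card := by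
    refine card_bij' (fun c _ v => (c v).rev) (fun c _ v => (c v).rev) ?_ ?_ ?_ ?_ <;> simp
  rw [← hB'] at hB
  obtain ⟨c, hc⟩ : ∃ c : V → Fin 4,
      c ∉ (univ.filter fun c : V → Fin 4 => ¬ ∃ i, ∀ v ∈ S i, c v = 0 ∨ c v = 1) ∪
        (univ.filter fun c : V → Fin 4 =>
          ¬ ∃ i, ∀ v ∈ T i, (c v).rev = 0 ∨ (c v).rev = 1) := by
    by_contra hall
    have := card_le_card (fun c _ => not_not.1 (not_exists.1 hall c) : (univ : Finset (V → Fin 4)) ⊆ _)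
    have hle := this.trans (card_union_le _ _)
    simp only [card_univ, Fintype.card_fun, Fintype.card_fin] at hle
    omega
  simp only [mem_union, mem_filter, mem_univ, true_and, not_or, not_not] at hc
  obtain ⟨⟨i, hi⟩, ⟨j, hj⟩⟩ := hc
  refine ⟨i, j, disjoint_left.2 fun v hv hv' => ?_⟩
  have hdec : ∀ x : Fin 4, (x = 0 ∨ x = 1) → ¬ (x.rev = 0 ∨ x.rev = 1) := by decide
  exact hdec _ (hi v hv) (hj v hv')

end Cover

/-! ### Spread cores of families of permutations. -/

section Cores

variable {n : ℕ}

/-- The graph of a permutation, as a set of pairs. -/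
def graph (σ : Equiv.Perm (Fin n)) : Finset (Fin n × Fin n) :=
  univ.filter fun p => σ p.1 = p.2

@[simp]
theorem mem_graph {σ : Equiv.Perm (Fin n)} {p : Fin n × Fin n} : p ∈ graph σ ↔ σ p.1 = p.2 := by
  simp [graph]

theorem card_graph (σ : Equiv.Perm (Fin n)) : (graph σ).card = n := by
  have : graph σ = univ.image fun k => (k, σ k) := by
    ext ⟨a, b⟩
    simp
  rw [this, card_image_of_injective _ fun a b h => (Prod.ext_iff.1 h).1, card_univ,
    Fintype.card_fin]

theorem disjoint_graph_iff {σ τ : Equiv.Perm (Fin n)} :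
    Disjoint (graph σ) (graph τ) ↔ ¬ Intersects σ τ := by
  rw [disjoint_left, Intersects]
  constructor
  · rintro h ⟨k, hk⟩
    exact h (a := (k, σ k)) (by simp) (by simp [hk])
  · rintro h ⟨a, b⟩ h1 h2
    exact h ⟨a, by simp_all⟩

theorem card_perm_fixing (P : Finset (Fin n)) :
    (univ.filter fun σ : Equiv.Perm (Fin n) => ∀ a ∈ P, σ a = a).card =
      (n - P.card).factorial := by
  have h := Fintype.card_congr (Equiv.Perm.subtypeEquivSubtypePerm fun a => a ∉ P)
  rw [Fintype.card_perm] at h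
  rw [← Fintype.card_subtype]
  simp only [not_not] at h
  rw [← h]
  congr 1
  rw [Fintype.card_subtype_compl]
  simp

theorem card_graph_superset_le (X : Finset (Fin n × Fin n)) :
    (univ.filter fun σ : Equiv.Perm (Fin n) => X ⊆ graph σ).card ≤
      (n - X.card).factorial := by
  classical
  by_cases h : ∃ σ₀ : Equiv.Perm (Fin n), X ⊆ graph σ₀
  · obtain ⟨σ₀, h₀⟩ := h
    have hcard : (X.image Prod.fst).card = X.card := by
      refine card_image_of_injOn ?_
      rintro ⟨a, b⟩ h1 ⟨a', b'⟩ h2 hab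
      have e1 := mem_graph.1 (h₀ h1)
      have e2 := mem_graph.1 (h₀ h2)
      simp_all
    rw [← hcard, ← card_perm_fixing]
    refine card_le_card_of_injOn (fun σ => σ₀⁻¹ * σ) ?_ (fun σ _ τ _ h => mul_left_cancel h)
    intro σ hσ
    have hσ' : X ⊆ graph σ := by simpa using hσ
    simp only [coe_filter, mem_univ, true_and, Set.mem_ofPred_eq, mem_image, Prod.exists,
      exists_and_right, exists_eq_right, forall_exists_index]
    intro a b hab
    have e1 := mem_graph.1 (h₀ hab)
    have e2 := mem_graph.1 (hσ' hab)
    simp only [Equiv.Perm.mul_apply, Equiv.Perm.inv_eq_iff_eq]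
    simp_all
  · push Not at h
    rw [filter_false_of_mem (by simpa using h)]
    simp

/-- `X` is a core of `A` if some nonempty subfamily of `A`, all of whose members extend `X`, is
`r`-spread outside `X`. -/
def IsCore (A : Finset (Equiv.Perm (Fin n))) (r : ℝ) (X : Finset (Fin n × Fin n)) : Prop :=
  ∃ F ⊆ A, F.Nonempty ∧ (∀ σ ∈ F, X ⊆ graph σ) ∧
    ∀ Y, Disjoint X Y → r ^ Y.card * ((F.filter fun σ => Y ⊆ graph σ).card : ℝ) ≤ F.card

/-- Only few members of `A` contain no small core of `A`. -/
theorem card_without_core_le (A R : Finset (Equiv.Perm (Fin n))) {r E : ℝ} (hr : 0 < r) (q : ℕ)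
    (hRA : R ⊆ A) (hE : 0 ≤ E)
    (hR : ∀ σ ∈ R, ∀ X ⊆ graph σ, X.card ≤ q → ¬ IsCore A r X)
    (hb : ∀ k, q < k → k ≤ n → r ^ k * ((n - k).factorial : ℝ) ≤ E) :
    (R.card : ℝ) ≤ E := by
  classical
  rcases R.eq_empty_or_nonempty with rfl | hne
  · simpa using hE
  -- Maximality of |X| is exactly r-spreadness of the members of R containing X. So X is a core, its
  -- size must exceed q, and the count of permutations through X bounds R.
  obtain ⟨X, hX, hmax⟩ := exists_max_image
    (univ.filter fun X : Finset (Fin n × Fin n) =>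
      (R.card : ℝ) ≤ r ^ X.card * (R.filter fun σ => X ⊆ graph σ).card) (fun X => X.card)
    ⟨∅, by simp⟩
  have hX' := (mem_filter.1 hX).2
  have hRpos : (0 : ℝ) < R.card := by exact_mod_cast hne.card_pos
  have hFne : (R.filter fun σ => X ⊆ graph σ).Nonempty := by
    rw [nonempty_iff_ne_empty]
    intro h
    rw [h] at hX'
    simp at hX'
    simp [hX'] at hRpos
  obtain ⟨σ, hσ⟩ := hFne
  have hσ' := mem_filter.1 hσ
  have hcore : IsCore A r X := by
    refine ⟨R.filter fun σ => X ⊆ graph σ, (filter_subset _ _).trans hRA, ⟨σ, hσ⟩,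
      fun τ hτ => (mem_filter.1 hτ).2, fun Y hXY => ?_⟩
    rcases Y.eq_empty_or_nonempty with rfl | hY
    · simp
    have hnot : X ∪ Y ∉ (univ.filter fun X : Finset (Fin n × Fin n) =>
      (R.card : ℝ) ≤ r ^ X.card * (R.filter fun σ => X ⊆ graph σ).card) := by
      intro h
      have := hmax _ h
      rw [card_union_of_disjoint hXY] at this
      have := hY.card_pos
      omega
    simp only [mem_filter, mem_univ, true_and, not_le] at hnot
    rw [card_union_of_disjoint hXY, pow_add] at hnot
    have heq : (R.filter fun σ => X ⊆ graph σ).filter (fun σ => Y ⊆ graph σ) =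
        R.filter fun σ => X ∪ Y ⊆ graph σ := by
      rw [filter_filter]
      simp only [union_subset_iff]
    rw [heq]
    have h3 := hnot.le.trans hX'
    rw [mul_assoc] at h3
    exact le_of_mul_le_mul_left h3 (by positivity)
  have hq : q < X.card := by
    by_contra h
    exact hR σ hσ'.1 X hσ'.2 (not_lt.1 h) hcore
  have hn : X.card ≤ n := by
    have := card_le_card hσ'.2
    rwa [card_graph] at this
  refine hX'.trans (le_trans ?_ (hb _ hq hn))
  gcongr
  refine le_trans (card_le_card ?_) (card_graph_superset_le X)
  exact filter_subset_filter _ (subset_univ _)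

/-- By spreadness each of the at most q points of X' lies in at most |F|/r members, so at most half
of F meets X'. This halving is the source of the factor 2 in the spread hypotheses above. -/
theorem card_disjoint_ge {F : Finset (Equiv.Perm (Fin n))} {r : ℝ} {q : ℕ}
    {X X' : Finset (Fin n × Fin n)} (hr : 0 < r) (hq : 2 * q ≤ r) (hX' : X'.card ≤ q)
    (hdis : Disjoint X X')
    (hF : ∀ Y, Disjoint X Y → r ^ Y.card * ((F.filter fun σ => Y ⊆ graph σ).card : ℝ) ≤ F.card) :
    (F.card : ℝ) ≤ 2 * (F.filter fun σ => Disjoint X' (graph σ)).card := by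
  classical
  have hcover : F.filter (fun σ => ¬ Disjoint X' (graph σ)) ⊆
      X'.biUnion fun x => F.filter fun σ => {x} ⊆ graph σ := by
    intro σ hσ
    obtain ⟨hσF, h⟩ := mem_filter.1 hσ
    obtain ⟨x, hx, hx'⟩ := not_disjoint_iff.1 h
    exact mem_biUnion.2 ⟨x, hx, mem_filter.2 ⟨hσF, singleton_subset_iff.2 hx'⟩⟩
  have h1 : ((F.filter fun σ => ¬ Disjoint X' (graph σ)).card : ℝ) ≤
      ∑ x ∈ X', ((F.filter fun σ => {x} ⊆ graph σ).card : ℝ) := by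
    exact_mod_cast (card_le_card hcover).trans card_biUnion_le
  have h2 : r * ((F.filter fun σ => ¬ Disjoint X' (graph σ)).card : ℝ) ≤ q * F.card := by
    calc r * ((F.filter fun σ => ¬ Disjoint X' (graph σ)).card : ℝ)
        ≤ r * ∑ x ∈ X', ((F.filter fun σ => {x} ⊆ graph σ).card : ℝ) := by gcongr
      _ = ∑ x ∈ X', r * ((F.filter fun σ => {x} ⊆ graph σ).card : ℝ) := mul_sum _ _ _
      _ ≤ ∑ x ∈ X', (F.card : ℝ) := by
          refine sum_le_sum fun x hx => ?_
          have := hF {x} (disjoint_singleton_right.2 (disjoint_right.1 hdis hx))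
          simpa using this
      _ = X'.card * F.card := by simp
      _ ≤ q * F.card := by gcongr
  have h3 : ((F.filter fun σ => Disjoint X' (graph σ)).card : ℝ) +
      (F.filter fun σ => ¬ Disjoint X' (graph σ)).card = F.card := by
    exact_mod_cast card_filter_add_card_filter_not _
  have h4 : r * (2 * ((F.filter fun σ => ¬ Disjoint X' (graph σ)).card : ℝ)) ≤ r * F.card := by
    have : (2 * q : ℝ) * F.card ≤ r * F.card := by gcongr
    linarith
  have h5 := le_of_mul_le_mul_left h4 hr
  linarith

theorem spread_sdiff {F : Finset (Equiv.Perm (Fin n))} {r : ℝ} {q : ℕ}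
    {X X' : Finset (Fin n × Fin n)} (hr : 0 < r) (hq : 2 * q ≤ r) (hX' : X'.card ≤ q)
    (hdis : Disjoint X X')
    (hF : ∀ Y, Disjoint X Y → r ^ Y.card * ((F.filter fun σ => Y ⊆ graph σ).card : ℝ) ≤ F.card)
    (Y : Finset (Fin n × Fin n)) :
    ((univ.filter fun σ : F.filter (fun σ => Disjoint X' (graph σ)) =>
      Y ⊆ graph σ.1 \ X).card : ℝ) ≤
      2 * Fintype.card (F.filter fun σ => Disjoint X' (graph σ)) * r⁻¹ ^ Y.card := by
  classical
  rw [Fintype.card_coe]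
  by_cases hXY : Disjoint X Y
  · have h1 := hF Y hXY
    have h2 := card_disjoint_ge hr hq hX' hdis hF
    have h3 : ((univ.filter fun σ : F.filter (fun σ => Disjoint X' (graph σ)) =>
        Y ⊆ graph σ.1 \ X).card : ℝ) ≤ (F.filter fun σ => Y ⊆ graph σ).card := by
      norm_cast
      refine card_le_card_of_injOn (fun i => i.1) ?_ Subtype.val_injective.injOn
      intro σ hσ
      have hσ' : Y ⊆ graph σ.1 \ X := by simpa using hσ
      simpa [(mem_filter.1 σ.2).1] using hσ'.trans sdiff_subset
    rw [inv_pow, ← div_eq_mul_inv, le_div_iff₀ (by positivity)]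
    calc _ ≤ ((F.filter fun σ => Y ⊆ graph σ).card : ℝ) * r ^ Y.card := by gcongr
      _ ≤ _ := by linarith
  · have : (univ.filter fun σ : F.filter (fun σ => Disjoint X' (graph σ)) =>
      Y ⊆ graph σ.1 \ X) = ∅ := by
      refine filter_false_of_mem fun σ _ h => hXY ?_
      exact disjoint_of_subset_right h disjoint_sdiff
    rw [this]
    simp only [card_empty, Nat.cast_zero]
    positivity

/-- Small cores of cross-intersecting families intersect. -/
theorem not_disjoint_of_isCore {A B : Finset (Equiv.Perm (Fin n))} (hAB : CrossIntersecting A B)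
    {r : ℝ} {q m : ℕ} (hr : 0 < r) (hq : 2 * q ≤ r)
    (h1 : 16 * (1 + 6 * r⁻¹) ^ n ≤ 2 ^ m) (h2 : (1 + 128 * r⁻¹) ^ m ≤ 2)
    {X X' : Finset (Fin n × Fin n)} (hX : IsCore A r X) (hX' : IsCore B r X')
    (hXq : X.card ≤ q) (hXq' : X'.card ≤ q) : ¬ Disjoint X X' := by
  classical
  intro hdis
  obtain ⟨F, hFA, hFne, hFX, hF⟩ := hX
  obtain ⟨G, hGB, hGne, hGX, hG⟩ := hX'
  have hcF := card_disjoint_ge hr hq hXq' hdis hF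
  have hcG := card_disjoint_ge hr hq hXq hdis.symm hG
  have hFpos : (0 : ℝ) < F.card := by exact_mod_cast hFne.card_pos
  have hGpos : (0 : ℝ) < G.card := by exact_mod_cast hGne.card_pos
  have hneF : (F.filter fun σ => Disjoint X' (graph σ)).Nonempty := by
    rw [← card_pos]
    have : (0 : ℝ) < (F.filter fun σ => Disjoint X' (graph σ)).card := by linarith
    exact_mod_cast this
  have hneG : (G.filter fun σ => Disjoint X (graph σ)).Nonempty := by
    rw [← card_pos]
    have : (0 : ℝ) < (G.filter fun σ => Disjoint X (graph σ)).card := by linarith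
    exact_mod_cast this
  have := hneF.to_subtype
  have := hneG.to_subtype
  obtain ⟨σ, τ, hst⟩ := exists_disjoint_of_spread
    (fun σ : F.filter (fun σ => Disjoint X' (graph σ)) => graph σ.1 \ X)
    (fun σ : G.filter (fun σ => Disjoint X (graph σ)) => graph σ.1 \ X')
    (k := n) (m := m)
    (fun σ => (card_le_card sdiff_subset).trans (card_graph _).le)
    (fun σ => (card_le_card sdiff_subset).trans (card_graph _).le)
    (inv_nonneg.2 hr.le) (spread_sdiff hr hq hXq' hdis hF)
    (spread_sdiff hr hq hXq hdis.symm hG) h1 h2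
  obtain ⟨hσF, hσ⟩ := mem_filter.1 σ.2
  obtain ⟨hτG, hτ⟩ := mem_filter.1 τ.2
  refine disjoint_graph_iff.1 ?_ (hAB _ (hFA hσF) _ (hGB hτG))
  -- σ avoids X' and τ avoids X, so a common pair would lie outside both cores, where the graphs are
  -- disjoint.
  rw [disjoint_left] at hst hσ hτ ⊢
  intro p hp hp'
  by_cases hpX : p ∈ X
  · exact hτ hpX hp'
  by_cases hpX' : p ∈ X'
  · exact hσ hpX' hp
  exact hst (mem_sdiff.2 ⟨hp, hpX⟩) (mem_sdiff.2 ⟨hp', hpX'⟩)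

end Cores

/-! ### Approximation by a single 1-coset. -/

section Stability

variable {n : ℕ}

theorem mem_oneCoset {i j : Fin n} {σ : Equiv.Perm (Fin n)} : σ ∈ oneCoset i j ↔ σ i = j := by
  simp [oneCoset]

theorem card_le_of_cores {A : Finset (Equiv.Perm (Fin n))} {r E : ℝ} (hr : 0 < r) (q : ℕ)
    (hE : 0 ≤ E) (hb : ∀ k, q < k → k ≤ n → r ^ k * ((n - k).factorial : ℝ) ≤ E)
    (Q : Finset (Finset (Fin n × Fin n))) (hQ : ∀ P ∈ Q, P.card = 2)
    (hcov : ∀ X, IsCore A r X → X.card ≤ q → ∃ P ∈ Q, P ⊆ X) :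
    (A.card : ℝ) ≤ Q.card * ((n - 2).factorial : ℝ) + E := by
  classical
  set R := A.filter fun σ => ∀ X ⊆ graph σ, X.card ≤ q → ¬ IsCore A r X with hR
  have hRE : (R.card : ℝ) ≤ E := card_without_core_le A R hr q (filter_subset _ _) hE
    (fun σ hσ => (mem_filter.1 hσ).2) hb
  have hsub : A ⊆ Q.biUnion (fun P => univ.filter fun σ => P ⊆ graph σ) ∪ R := by
    intro σ hσ
    by_cases hσR : σ ∈ R
    · exact mem_union_right _ hσR
    · have : ∃ X ⊆ graph σ, X.card ≤ q ∧ IsCore A r X := by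
        by_contra! h
        exact hσR (mem_filter.2 ⟨hσ, h⟩)
      obtain ⟨X, hX, hXq, hcore⟩ := this
      obtain ⟨P, hP, hPX⟩ := hcov X hcore hXq
      exact mem_union_left _ (mem_biUnion.2 ⟨P, hP, by simpa using hPX.trans hX⟩)
  have h1 : A.card ≤ Q.card * (n - 2).factorial + R.card := by
    refine (card_le_card hsub).trans ((card_union_le _ _).trans (Nat.add_le_add_right ?_ _))
    refine card_biUnion_le_card_mul _ _ _ fun P hP => ?_
    rw [← hQ P hP]
    exact card_graph_superset_le P
  have h2 : (A.card : ℝ) ≤ Q.card * ((n - 2).factorial : ℝ) + R.card := by exact_mod_cast h1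
  linarith

theorem card_sdiff_oneCoset_le {A : Finset (Equiv.Perm (Fin n))} {r E : ℝ} (hr : 0 < r) (q : ℕ)
    (hE : 0 ≤ E) (hb : ∀ k, q < k → k ≤ n → r ^ k * ((n - k).factorial : ℝ) ≤ E)
    (y : Fin n × Fin n) (hy : ∀ X, IsCore A r X → X.card ≤ q → y ∈ X) :
    ((A \ oneCoset y.1 y.2).card : ℝ) ≤ E := by
  refine card_without_core_le A _ hr q sdiff_subset hE ?_ hb
  intro σ hσ X hX hXq hcore
  refine (mem_sdiff.1 hσ).2 (mem_oneCoset.2 ?_)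
  exact mem_graph.1 (hX (hy X hcore hXq))

/-- Large cross-intersecting families are almost contained in a common 1-coset. -/
theorem exists_oneCoset_almost_containing {A B : Finset (Equiv.Perm (Fin n))}
    (hAB : CrossIntersecting A B) (hn : 0 < n) {r E : ℝ} {q m : ℕ} (hr : 0 < r) (hq : 2 * q ≤ r)
    (h1 : 16 * (1 + 6 * r⁻¹) ^ n ≤ 2 ^ m) (h2 : (1 + 128 * r⁻¹) ^ m ≤ 2) (hE : 0 ≤ E)
    (hb : ∀ k, q < k → k ≤ n → r ^ k * ((n - k).factorial : ℝ) ≤ E)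
    (hA : (q : ℝ) ^ 2 * ((n - 2).factorial : ℝ) + E < A.card)
    (hB : (q : ℝ) ^ 2 * ((n - 2).factorial : ℝ) + E < B.card) :
    ∃ i j, ((A \ oneCoset i j).card : ℝ) ≤ E ∧ ((B \ oneCoset i j).card : ℝ) ≤ E := by
  classical
  have hmeet : ∀ X X', IsCore A r X → X.card ≤ q → IsCore B r X' → X'.card ≤ q →
      ∃ x ∈ X, x ∈ X' := fun X X' hX hXq hX' hXq' =>
    not_disjoint_iff.1 (not_disjoint_of_isCore hAB hr hq h1 h2 hX hX' hXq hXq')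
  have hcontra : ∀ D : Finset (Equiv.Perm (Fin n)),
      (q : ℝ) ^ 2 * ((n - 2).factorial : ℝ) + E < D.card →
      ∀ Q : Finset (Finset (Fin n × Fin n)), Q.card ≤ q ^ 2 → (∀ P ∈ Q, P.card = 2) →
        ¬ ∀ X, IsCore D r X → X.card ≤ q → ∃ P ∈ Q, P ⊆ X := by
    intro D hD Q hQc hQ hcov
    have h := card_le_of_cores hr q hE hb Q hQ hcov
    have : (Q.card : ℝ) * ((n - 2).factorial : ℝ) ≤ (q : ℝ) ^ 2 * ((n - 2).factorial : ℝ) := by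
      gcongr
      exact_mod_cast hQc
    linarith
  by_cases hy : ∃ y, ∀ X, IsCore A r X → X.card ≤ q → y ∈ X
  · obtain ⟨y, hy⟩ := hy
    refine ⟨y.1, y.2, card_sdiff_oneCoset_le hr q hE hb y hy,
      card_sdiff_oneCoset_le hr q hE hb y ?_⟩
    intro X' hX' hXq'
    by_contra hyX
    -- If a small core X' of B misses y, every small core of A contains y together with a point of
    -- X'.
    refine hcontra A hA (X'.image fun x => {y, x}) ?_ ?_ ?_
    · exact card_image_le.trans (hXq'.trans (Nat.le_self_pow two_ne_zero q))
    · intro P hP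
      obtain ⟨x, hx, rfl⟩ := mem_image.1 hP
      exact card_pair fun h => hyX (h ▸ hx)
    · intro X hX hXq
      obtain ⟨x, hx, hx'⟩ := hmeet X X' hX hXq hX' hXq'
      exact ⟨{y, x}, mem_image_of_mem _ hx', insert_subset (hy X hX hXq) (by simpa using hx)⟩
  · push Not at hy
    choose Y hY hYq hyY using hy
    let Y₀ := Y (⟨0, hn⟩, ⟨0, hn⟩)
    exfalso
    -- Every small core of B meets Y₀ in some y, and also meets the core `Y y`, which misses y; this
    -- gives two distinct points with at most q² choices.
    refine hcontra B hB (Y₀.biUnion fun y => (Y y).image fun x => {y, x}) ?_ ?_ ?_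
    · rw [pow_two]
      exact (card_biUnion_le_card_mul _ _ q fun y _ => card_image_le.trans (hYq y)).trans
        (Nat.mul_le_mul_right _ (hYq _))
    · intro P hP
      obtain ⟨y, -, hP⟩ := mem_biUnion.1 hP
      obtain ⟨x, hx, rfl⟩ := mem_image.1 hP
      exact card_pair fun h => hyY y (h ▸ hx)
    · intro X hX hXq
      obtain ⟨y, hy, hyX⟩ := hmeet Y₀ X (hY _) (hYq _) hX hXq
      obtain ⟨x, hx, hxX⟩ := hmeet (Y y) X (hY _) (hYq _) hX hXq
      exact ⟨{y, x}, mem_biUnion.2 ⟨y, hy, mem_image_of_mem _ hx⟩,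
        insert_subset hyX (by simpa using hxX)⟩

end Stability

/-! ### Counting permutations in a 1-coset that avoid or meet given permutations. -/

section Counting

variable {n : ℕ}

theorem card_perm_fixedPoints_eq (P : Finset (Fin n)) :
    (univ.filter fun σ : Equiv.Perm (Fin n) => ∀ a, σ a = a ↔ a ∈ P).card =
      numDerangements (n - P.card) := by
  classical
  have h := Fintype.card_congr (derangements.subtypeEquiv fun a : Fin n => a ∉ P)
  rw [card_derangements_eq_numDerangements] at h
  rw [← Fintype.card_subtype]
  have h2 : Fintype.card {a : Fin n // a ∉ P} = n - P.card := by
    rw [Fintype.card_subtype_compl]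
    simp
  rw [← h2, h]
  refine Fintype.card_congr (Equiv.subtypeEquivRight fun σ => forall_congr' fun a => ?_)
  simp only [not_not, Function.mem_fixedPoints, Function.IsFixedPt]
  exact Iff.comm

/-- The two cases are f k ≠ i and f k = i; they produce the terms d_{n-1} and d_{n-2}. -/
theorem derangement_apply_eq_iff {f : Equiv.Perm (Fin n)} {i k : Fin n} (hik : i ≠ k) :
    (f i = k ∧ ∀ u, f u ≠ u) ↔
      (∀ a, (Equiv.swap i k * f) a = a ↔ a ∈ ({i} : Finset (Fin n))) ∨
      (∀ a, (Equiv.swap i k * f) a = a ↔ a ∈ ({i, k} : Finset (Fin n))) := by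
  have hg : ∀ a, (Equiv.swap i k * f) a = a ↔ f a = Equiv.swap i k a := by
    intro a
    rw [Equiv.Perm.mul_apply, Equiv.swap_apply_eq_iff]
  simp only [hg, mem_insert, mem_singleton]
  constructor
  · rintro ⟨hi, hf⟩
    by_cases hk : f k = i
    · right
      intro a
      by_cases h1 : a = i
      · simp [h1, hi]
      by_cases h2 : a = k
      · simp [h2, hk]
      simp [Equiv.swap_apply_of_ne_of_ne h1 h2, h1, h2, hf]
    · left
      intro a
      by_cases h1 : a = i
      · simp [h1, hi]
      by_cases h2 : a = k
      · simp [h2, hk, hik.symm]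
      simp [Equiv.swap_apply_of_ne_of_ne h1 h2, h1, hf]
  · intro h
    have hi : f i = k := by
      rcases h with h | h <;> simpa using (h i).2 (by simp)
    refine ⟨hi, fun u hu => ?_⟩
    have h1 : u ≠ i := by
      rintro rfl
      exact hik (hu.symm.trans hi)
    have h2 : u ≠ k := by
      rintro rfl
      exact hik (f.injective (hi.trans hu.symm))
    have h3 : f u = Equiv.swap i k u := by rw [Equiv.swap_apply_of_ne_of_ne h1 h2, hu]
    rcases h with h | h
    · exact h1 ((h u).1 h3)
    · rcases (h u).1 h3 with h | h
      · exact h1 h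
      · exact h2 h

/-- The members of a 1-coset that do not intersect `τ`. -/
def cosetAvoiding (i j : Fin n) (τ : Equiv.Perm (Fin n)) : Finset (Equiv.Perm (Fin n)) :=
  univ.filter fun σ => σ i = j ∧ ¬ Intersects σ τ

theorem card_cosetAvoiding {i j : Fin n} {τ : Equiv.Perm (Fin n)} (h : τ i ≠ j) :
    (cosetAvoiding i j τ).card = numDerangements (n - 1) + numDerangements (n - 2) := by
  classical
  set k := τ⁻¹ j with hk
  have hτk : τ k = j := by simp [hk]
  have hik : i ≠ k := by
    rintro hik
    exact h (hik ▸ hτk)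
  have h1 := card_perm_fixedPoints_eq ({i} : Finset (Fin n))
  have h2 := card_perm_fixedPoints_eq ({i, k} : Finset (Fin n))
  rw [card_singleton] at h1
  rw [card_pair hik] at h2
  rw [← h1, ← h2, ← card_union_of_disjoint]
  · refine card_equiv (Equiv.mulLeft (Equiv.swap i k * τ⁻¹)) fun σ => ?_
    rw [mem_union, mem_filter, mem_filter]
    simp only [mem_univ, true_and, Equiv.coe_mulLeft, mul_assoc]
    rw [← derangement_apply_eq_iff hik]
    simp only [cosetAvoiding, mem_filter, mem_univ, true_and, Intersects, not_exists,
      Equiv.Perm.mul_apply, ne_eq, Equiv.Perm.inv_eq_iff_eq, hτk]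
  · rw [disjoint_left]
    intro σ hσ hσ'
    have e1 := (mem_filter.1 hσ).2 k
    have e2 := (mem_filter.1 hσ').2 k
    have e3 := e1.1 (e2.2 (by simp))
    exact hik (mem_singleton.1 e3).symm

theorem card_oneCoset (i j : Fin n) : (oneCoset i j).card = (n - 1).factorial := by
  have h := card_perm_fixing ({i} : Finset (Fin n))
  rw [card_singleton] at h
  rw [← h]
  refine card_equiv (Equiv.mulLeft (Equiv.swap i j)) fun σ => ?_
  simp [oneCoset, Equiv.swap_apply_eq_iff]

theorem card_cosetMeeting_add {i j : Fin n} {τ : Equiv.Perm (Fin n)} (h : τ i ≠ j) :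
    (cosetMeeting i j τ).card + (numDerangements (n - 1) + numDerangements (n - 2)) =
      (n - 1).factorial := by
  rw [← card_cosetAvoiding h, ← card_oneCoset i j, cosetMeeting, cosetAvoiding, oneCoset,
    ← filter_filter, ← filter_filter, card_filter_add_card_filter_not]

/-- Modify τ to a permutation θ with θ i = j and θ x = y. If g fixes exactly i and x, then θ g
avoids τ, and there are d_{n-2} such g. -/
theorem le_card_two_values_avoiding {i x j y : Fin n} {τ : Equiv.Perm (Fin n)} (hix : i ≠ x)
    (hjy : j ≠ y) (hi : τ i ≠ j) (hx : τ x ≠ y) :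
    numDerangements (n - 2) ≤ ((cosetAvoiding i j τ).filter fun σ => σ x = y).card := by
  classical
  have h2 := card_perm_fixedPoints_eq ({i, x} : Finset (Fin n))
  rw [card_pair hix] at h2
  rw [← h2]
  let θ₁ : Equiv.Perm (Fin n) := Equiv.swap j (τ i) * τ
  let θ : Equiv.Perm (Fin n) := Equiv.swap y (θ₁ x) * θ₁
  have hθ₁i : θ₁ i = j := by simp [θ₁]
  have hθx : θ x = y := by simp [θ]
  have hθi : θ i = j := by
    have hne : j ≠ θ₁ x := by
      rw [← hθ₁i]
      exact fun h => hix (θ₁.injective h)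
    simp only [θ, Equiv.Perm.mul_apply, hθ₁i]
    exact Equiv.swap_apply_of_ne_of_ne hjy hne
  have hθu : ∀ u, u ≠ i → u ≠ x → τ u ≠ j → τ u ≠ y → θ u = τ u := by
    intro u h1 h2 h3 h4
    have e1 : θ₁ u = τ u := by
      simp only [θ₁, Equiv.Perm.mul_apply]
      exact Equiv.swap_apply_of_ne_of_ne h3 fun h => h1 (τ.injective h)
    simp only [θ, Equiv.Perm.mul_apply]
    rw [Equiv.swap_apply_of_ne_of_ne, e1]
    · rwa [e1]
    · exact fun h => h2 (θ₁.injective h)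
  refine card_le_card_of_injOn (fun g => θ * g) ?_ (fun σ _ τ _ h => mul_left_cancel h)
  intro g hg
  have hg' : ∀ a, g a = a ↔ a ∈ ({i, x} : Finset (Fin n)) := by simpa using hg
  have hgi : g i = i := (hg' i).2 (by simp)
  have hgx : g x = x := (hg' x).2 (by simp)
  simp only [cosetAvoiding, coe_filter, mem_filter, mem_univ, true_and, Set.mem_ofPred_eq,
    Equiv.Perm.mul_apply, hgi, hgx, hθi, hθx, and_true, Intersects, not_exists]
  intro u hu
  have h1 : u ≠ i := by
    rintro rfl
    rw [hgi, hθi] at hu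
    exact hi hu.symm
  have h2 : u ≠ x := by
    rintro rfl
    rw [hgx, hθx] at hu
    exact hx hu.symm
  have h3 : τ u ≠ j := by
    intro h
    rw [h, ← hθi] at hu
    have := θ.injective hu
    rw [← hgi] at this
    exact h1 (by simpa [hgi] using g.injective this)
  have h4 : τ u ≠ y := by
    intro h
    rw [h, ← hθx] at hu
    have := θ.injective hu
    rw [← hgx] at this
    exact h2 (by simpa [hgx] using g.injective this)
  rw [← hθu u h1 h2 h3 h4] at hu
  have h5 := (hg' u).1 (θ.injective hu)
  simp [h1, h2] at h5

/-- The points other than `i` where `π` and `τ` differ, and whose image under `π` is not `j`. -/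
def freePoints (i j : Fin n) (π τ : Equiv.Perm (Fin n)) : Finset (Fin n) :=
  univ.filter fun x => x ≠ i ∧ π x ≠ j ∧ π x ≠ τ x

theorem card_freePoints_ge (i j : Fin n) (π τ : Equiv.Perm (Fin n)) :
    n ≤ (freePoints i j π τ).card + (univ.filter fun x => π x = τ x).card + 2 := by
  classical
  have h : (univ : Finset (Fin n)) ⊆
      freePoints i j π τ ∪ (univ.filter fun x => π x = τ x) ∪ {i, π⁻¹ j} := by
    intro x _
    simp only [freePoints, mem_union, mem_filter, mem_univ, true_and, mem_insert, mem_singleton,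
      Equiv.Perm.eq_inv_iff_eq]
    tauto
  have := card_le_card h
  rw [card_univ, Fintype.card_fin] at this
  refine this.trans ((card_union_le _ _).trans ?_)
  exact add_le_add (card_union_le _ _) card_le_two

/-- Otherwise π and τ agree off i and π⁻¹ j. Since τ⁻¹ j ≠ i, this forces π⁻¹ j = τ⁻¹ j, so they
agree off i and hence everywhere. -/
theorem freePoints_nonempty {i j : Fin n} {π τ : Equiv.Perm (Fin n)} (hne : π ≠ τ) (hτ : τ i ≠ j) :
    (freePoints i j π τ).Nonempty := by
  by_contra hemp
  have hall : ∀ x, x ≠ i → π x ≠ j → π x = τ x := by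
    intro x h1 h2
    by_contra h3
    exact hemp ⟨x, by simp [freePoints, h1, h2, h3]⟩
  set b := τ⁻¹ j with hb
  have hτb : τ b = j := by simp [hb]
  have hbi : b ≠ i := by
    rintro h
    exact hτ (h ▸ hτb)
  have hπb : π b = j := by
    by_contra h
    exact h ((hall b hbi h).trans hτb)
  refine hne (Equiv.ext fun x => ?_)
  by_cases hxb : x = b
  · rw [hxb, hπb, hτb]
  have hx : ∀ z, z ≠ i → π z = τ z := by
    intro z hz
    by_cases h : π z = j
    · have : z = b := π.injective (h.trans hπb.symm)
      rw [this, hπb, hτb]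
    · exact hall z hz h
  by_cases hxi : x = i
  · subst hxi
    obtain ⟨z, hz⟩ := π.surjective (τ x)
    by_cases hzx : z = x
    · rw [← hz, hzx]
    · have := (hx z hzx).symm.trans hz
      exact absurd (τ.injective this) hzx
  · exact hx x hxi

/-- The members of a 1-coset that intersect `π` but not `τ`. -/
def cosetSeparating (i j : Fin n) (π τ : Equiv.Perm (Fin n)) : Finset (Equiv.Perm (Fin n)) :=
  (cosetAvoiding i j τ).filter fun σ => Intersects σ π

theorem numDerangements_le_card_cosetSeparating {i j : Fin n} {π τ : Equiv.Perm (Fin n)}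
    (hne : π ≠ τ) (hτ : τ i ≠ j) :
    numDerangements (n - 2) ≤ (cosetSeparating i j π τ).card := by
  obtain ⟨x, hx⟩ := freePoints_nonempty hne hτ
  simp only [freePoints, mem_filter, mem_univ, true_and] at hx
  refine (le_card_two_values_avoiding hx.1.symm hx.2.1.symm hτ (Ne.symm hx.2.2)).trans
    (card_le_card ?_)
  intro σ hσ
  obtain ⟨h1, h2⟩ := mem_filter.1 hσ
  exact mem_filter.2 ⟨h1, x, h2⟩

theorem card_three_values_le {i j : Fin n} {π : Equiv.Perm (Fin n)} {x x' : Fin n} (hxi : x ≠ i)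
    (hxi' : x' ≠ i) (hne : x ≠ x') :
    ((oneCoset i j).filter fun σ => σ x = π x ∧ σ x' = π x').card ≤ (n - 3).factorial := by
  classical
  have h := card_graph_superset_le ({(i, j), (x, π x), (x', π x')} : Finset (Fin n × Fin n))
  rw [card_eq_three.2 ⟨_, _, _, by simp [hxi.symm], by simp [hxi'.symm], by simp [hne], rfl⟩] at h
  refine le_trans (card_le_card ?_) h
  intro σ hσ
  simp only [oneCoset, mem_filter, mem_univ, true_and] at hσ
  simp [insert_subset_iff, hσ]

theorem card_two_values_le {i j : Fin n} {π : Equiv.Perm (Fin n)} {x : Fin n} (hxi : x ≠ i) :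
    ((oneCoset i j).filter fun σ => σ x = π x).card ≤ (n - 2).factorial := by
  classical
  have h := card_graph_superset_le ({(i, j), (x, π x)} : Finset (Fin n × Fin n))
  rw [card_pair (by simp [hxi.symm])] at h
  refine le_trans (card_le_card ?_) h
  intro σ hσ
  simp only [oneCoset, mem_filter, mem_univ, true_and] at hσ
  simp [insert_subset_iff, hσ]

theorem sum_sq_card_agree_le (i j : Fin n) (π : Equiv.Perm (Fin n)) (T : Finset (Fin n))
    (hT : i ∉ T) :
    ∑ σ ∈ oneCoset i j, (T.filter fun x => σ x = π x).card ^ 2 ≤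
      n * (n - 2).factorial + n ^ 2 * (n - 3).factorial := by
  classical
  have hTn : T.card ≤ n := by simpa using card_le_univ T
  have hTi : ∀ x ∈ T, x ≠ i := fun x hx h => hT (h ▸ hx)
  have e1 : ∀ σ : Equiv.Perm (Fin n), (T.filter fun x => σ x = π x).card ^ 2 =
      ∑ x ∈ T, ∑ x' ∈ T, if σ x = π x ∧ σ x' = π x' then 1 else 0 := by
    intro σ
    rw [pow_two, ← card_product, ← filter_product, card_filter, sum_product]
  calc ∑ σ ∈ oneCoset i j, (T.filter fun x => σ x = π x).card ^ 2
      = ∑ x ∈ T, ∑ x' ∈ T, ((oneCoset i j).filter fun σ => σ x = π x ∧ σ x' = π x').card := by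
        simp_rw [e1]
        rw [sum_comm]
        refine sum_congr rfl fun x _ => ?_
        rw [sum_comm]
        refine sum_congr rfl fun x' _ => ?_
        rw [card_filter]
    _ ≤ ∑ x ∈ T, ((n - 2).factorial + n * (n - 3).factorial) := by
        refine sum_le_sum fun x hx => ?_
        rw [← add_sum_erase _ _ hx]
        refine add_le_add ?_ ?_
        · simpa using card_two_values_le (hTi x hx)
        · calc _ ≤ ∑ x' ∈ T.erase x, (n - 3).factorial :=
                sum_le_sum fun x' hx' => card_three_values_le (hTi x hx)
                  (hTi x' (mem_of_mem_erase hx')) (ne_of_mem_erase hx').symm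
            _ = (T.erase x).card * (n - 3).factorial := by simp
            _ ≤ _ := Nat.mul_le_mul_right _ ((card_le_card (erase_subset _ _)).trans hTn)
    _ = T.card * ((n - 2).factorial + n * (n - 3).factorial) := by simp
    _ ≤ n * ((n - 2).factorial + n * (n - 3).factorial) := Nat.mul_le_mul_right _ hTn
    _ = _ := by ring

/-- Second-moment method: with a(σ) the number of free points where σ agrees with π, the indicator
of a > 0 is at least a/3 − a²/36, which is summed over the members of the coset avoiding τ. -/
theorem card_cosetSeparating_ge {i j : Fin n} {π τ : Equiv.Perm (Fin n)} (hτ : τ i ≠ j) :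
    ((freePoints i j π τ).card : ℝ) * numDerangements (n - 2) / 3 -
      (n * ((n - 2).factorial : ℝ) + n ^ 2 * ((n - 3).factorial : ℝ)) / 36 ≤
      (cosetSeparating i j π τ).card := by
  classical
  set T := freePoints i j π τ with hTdef
  let a : Equiv.Perm (Fin n) → ℕ := fun σ => (T.filter fun x => σ x = π x).card
  have hiT : i ∉ T := by simp [hTdef, freePoints]
  have hsum : T.card * numDerangements (n - 2) ≤ ∑ σ ∈ cosetAvoiding i j τ, a σ := by
    calc T.card * numDerangements (n - 2) = ∑ x ∈ T, numDerangements (n - 2) := by simp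
      _ ≤ ∑ x ∈ T, ((cosetAvoiding i j τ).filter fun σ => σ x = π x).card := by
          refine sum_le_sum fun x hx => ?_
          simp only [hTdef, freePoints, mem_filter, mem_univ, true_and] at hx
          exact le_card_two_values_avoiding hx.1.symm hx.2.1.symm hτ (Ne.symm hx.2.2)
      _ = _ := by
          simp_rw [a, card_filter]
          rw [sum_comm]
  have hsq : ∑ σ ∈ cosetAvoiding i j τ, a σ ^ 2 ≤
      n * (n - 2).factorial + n ^ 2 * (n - 3).factorial := by
    refine le_trans (sum_le_sum_of_subset ?_) (sum_sq_card_agree_le i j π T hiT)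
    intro σ hσ
    simp only [cosetAvoiding, mem_filter, mem_univ, true_and] at hσ
    exact mem_oneCoset.2 hσ.1
  have hind : ∑ σ ∈ cosetAvoiding i j τ, ((a σ : ℝ) / 3 - (a σ : ℝ) ^ 2 / 36) ≤
      ((cosetSeparating i j π τ).card : ℝ) := by
    rw [cosetSeparating, card_filter]
    push_cast
    refine sum_le_sum fun σ _ => ?_
    split_ifs with h
    · nlinarith [sq_nonneg ((a σ : ℝ) / 6 - 1)]
    · have : a σ = 0 := by
        simp only [a, card_eq_zero]
        refine filter_false_of_mem fun x _ hx => h ⟨x, hx⟩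
      simp [this]
  rw [sum_sub_distrib, ← sum_div, ← sum_div] at hind
  have hsum' : (T.card : ℝ) * numDerangements (n - 2) ≤ ∑ σ ∈ cosetAvoiding i j τ, (a σ : ℝ) := by
    exact_mod_cast hsum
  have hsq' : ∑ σ ∈ cosetAvoiding i j τ, (a σ : ℝ) ^ 2 ≤
      n * ((n - 2).factorial : ℝ) + n ^ 2 * ((n - 3).factorial : ℝ) := by
    exact_mod_cast hsq
  linarith

theorem card_agree_mul_factorial_le (π : Equiv.Perm (Fin n)) {t : ℕ} (ht : t ≤ n) :
    (univ.filter fun τ : Equiv.Perm (Fin n) =>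
      t ≤ (univ.filter fun x => π x = τ x).card).card * t.factorial ≤ n.factorial := by
  classical
  have hsub : (univ.filter fun τ : Equiv.Perm (Fin n) =>
      t ≤ (univ.filter fun x => π x = τ x).card) ⊆
      (powersetCard t univ).biUnion fun P =>
        univ.filter fun τ => ∀ x ∈ P, π x = τ x := by
    intro τ hτ
    obtain ⟨P, hP, hPc⟩ := exists_subset_card_eq (mem_filter.1 hτ).2
    refine mem_biUnion.2 ⟨P, mem_powersetCard.2 ⟨subset_univ _, hPc⟩, ?_⟩
    simp only [mem_filter, mem_univ, true_and]
    exact fun x hx => (mem_filter.1 (hP hx)).2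
  have hcard : ∀ P ∈ powersetCard t (univ : Finset (Fin n)),
      (univ.filter fun τ : Equiv.Perm (Fin n) => ∀ x ∈ P, π x = τ x).card ≤
        (n - t).factorial := by
    intro P hP
    rw [← (mem_powersetCard.1 hP).2, ← card_perm_fixing]
    refine (card_equiv (Equiv.mulLeft π⁻¹) fun τ => ?_).le
    simp [eq_comm, Equiv.eq_symm_apply]
  have h := (card_le_card hsub).trans (card_biUnion_le_card_mul _ _ _ hcard)
  rw [card_powersetCard, card_univ, Fintype.card_fin] at h
  calc _ ≤ n.choose t * (n - t).factorial * t.factorial := Nat.mul_le_mul_right _ h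
    _ = n.choose t * t.factorial * (n - t).factorial := by ring
    _ = _ := Nat.choose_mul_factorial_mul_factorial ht

end Counting

/-! ### From an approximate coset to the exact extremal structure. -/

section Extremal

variable {n : ℕ}

theorem card_inter_add_card_cosetSeparating_le {A B : Finset (Equiv.Perm (Fin n))}
    (hAB : CrossIntersecting A B) (i j : Fin n) {π τ : Equiv.Perm (Fin n)} (hπ : π ∈ B)
    (hτ : τ ∈ B) :
    (A ∩ oneCoset i j).card + (cosetSeparating i j π τ).card ≤ (cosetMeeting i j π).card := by
  classical
  rw [← card_union_of_disjoint]
  · refine card_le_card (union_subset ?_ ?_)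
    · intro σ hσ
      obtain ⟨h1, h2⟩ := mem_inter.1 hσ
      simp [cosetMeeting, mem_oneCoset.1 h2, hAB σ h1 π hπ]
    · intro σ hσ
      simp only [cosetSeparating, cosetAvoiding, mem_filter, mem_univ, true_and] at hσ
      simp [cosetMeeting, hσ]
  · rw [disjoint_left]
    intro σ hσ hσ'
    simp only [cosetSeparating, cosetAvoiding, mem_filter, mem_univ, true_and] at hσ'
    exact hσ'.1.2 (hAB σ (mem_inter.1 hσ).1 τ hτ)

/-- Two exceptional members of B agreeing at fewer than t points would cost A more inside the coset
than it has outside, so all of them lie among the permutations agreeing with a fixed one at t or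
more points. -/
theorem card_sdiff_oneCoset_le_numDerangements {A B : Finset (Equiv.Perm (Fin n))}
    (hAB : CrossIntersecting A B) {i j : Fin n} {t : ℕ}
    (hA : (n - 1).factorial + 1 ≤ A.card + (numDerangements (n - 1) + numDerangements (n - 2)))
    (hsep : ∀ π τ : Equiv.Perm (Fin n), τ i ≠ j → (univ.filter fun x => π x = τ x).card < t →
      (A \ oneCoset i j).card < (cosetSeparating i j π τ).card)
    (hagree : ∀ π : Equiv.Perm (Fin n), (univ.filter fun τ : Equiv.Perm (Fin n) =>
      t ≤ (univ.filter fun x => π x = τ x).card).card ≤ numDerangements (n - 2)) :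
    (B \ oneCoset i j).card ≤ numDerangements (n - 2) := by
  classical
  rcases (B \ oneCoset i j).eq_empty_or_nonempty with h | ⟨π, hπ⟩
  · simp [h]
  refine le_trans (card_le_card ?_) (hagree π)
  intro τ hτ
  rw [mem_sdiff, mem_oneCoset] at hπ hτ
  simp only [mem_filter, mem_univ, true_and]
  by_contra hlt
  have h1 := hsep π τ hτ.2 (not_le.1 hlt)
  have h2 := card_inter_add_card_cosetSeparating_le hAB i j hπ.1 hτ.1
  have h3 := card_cosetMeeting_add hπ.2
  have h4 := card_inter_add_card_sdiff A (oneCoset i j)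
  omega

/-- A second exceptional member would cost A at least d_{n-2}, all that A can have outside the
coset; A would then fall short by the +1 in `hA`. -/
theorem eq_of_mem_sdiff_oneCoset {A B : Finset (Equiv.Perm (Fin n))}
    (hAB : CrossIntersecting A B) {i j : Fin n}
    (hA : (n - 1).factorial + 1 ≤ A.card + (numDerangements (n - 1) + numDerangements (n - 2)))
    (hA' : (A \ oneCoset i j).card ≤ numDerangements (n - 2)) {π τ : Equiv.Perm (Fin n)}
    (hπ : π ∈ B \ oneCoset i j) (hτ : τ ∈ B \ oneCoset i j) : π = τ := by
  by_contra hne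
  rw [mem_sdiff, mem_oneCoset] at hπ hτ
  have h1 := numDerangements_le_card_cosetSeparating hne hτ.2
  have h2 := card_inter_add_card_cosetSeparating_le hAB i j hπ.1 hτ.1
  have h3 := card_cosetMeeting_add hπ.2
  have h4 := card_inter_add_card_sdiff A (oneCoset i j)
  omega

theorem sdiff_oneCoset_nonempty {A B : Finset (Equiv.Perm (Fin n))}
    (hAB : CrossIntersecting A B) {i j : Fin n}
    (hA : (n - 1).factorial + 1 ≤ A.card + (numDerangements (n - 1) + numDerangements (n - 2)))
    (hnot : ¬ (A ⊆ oneCoset i j ∧ B ⊆ oneCoset i j)) : (A \ oneCoset i j).Nonempty := by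
  rw [sdiff_nonempty]
  intro hsub
  obtain ⟨τ, hτ, hτ'⟩ := not_subset.1 fun h => hnot ⟨hsub, h⟩
  rw [mem_oneCoset] at hτ'
  have h1 := card_inter_add_card_cosetSeparating_le hAB i j hτ hτ
  have h2 := card_cosetMeeting_add hτ'
  rw [inter_eq_left.2 hsub] at h1
  omega

theorem eq_cosetMeeting_union {A B : Finset (Equiv.Perm (Fin n))}
    (hAB : CrossIntersecting A B) {i j : Fin n}
    (hA : (n - 1).factorial + 1 ≤ A.card + (numDerangements (n - 1) + numDerangements (n - 2)))
    {ρ τ : Equiv.Perm (Fin n)} (hρ : A \ oneCoset i j = {ρ}) (hτ : τ ∈ B) (hτ' : τ i ≠ j) :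
    A = cosetMeeting i j τ ∪ {ρ} := by
  have h4 := card_inter_add_card_sdiff A (oneCoset i j)
  rw [hρ, card_singleton] at h4
  have h3 := card_cosetMeeting_add hτ'
  have h : A ∩ oneCoset i j = cosetMeeting i j τ := by
    refine eq_of_subset_of_card_le ?_ (by omega)
    intro σ hσ
    obtain ⟨h1, h2⟩ := mem_inter.1 hσ
    simp [cosetMeeting, mem_oneCoset.1 h2, hAB σ h1 τ hτ]
  rw [← h, ← hρ, union_comm, sdiff_union_inter]

theorem CrossIntersecting.symm {A B : Finset (Equiv.Perm (Fin n))} (h : CrossIntersecting A B) :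
    CrossIntersecting B A := fun σ hσ τ hτ => by
  obtain ⟨k, hk⟩ := h τ hτ σ hσ
  exact ⟨k, hk.symm⟩

/-- Large cross-intersecting families almost contained in a common 1-coset, but not contained in
it, have the extremal form. -/
theorem extremal_form {A B : Finset (Equiv.Perm (Fin n))}
    (hAB : CrossIntersecting A B) {i j : Fin n} {t : ℕ}
    (hnot : ¬ (A ⊆ oneCoset i j ∧ B ⊆ oneCoset i j))
    (hA : (n - 1).factorial + 1 ≤ A.card + (numDerangements (n - 1) + numDerangements (n - 2)))
    (hB : (n - 1).factorial + 1 ≤ B.card + (numDerangements (n - 1) + numDerangements (n - 2)))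
    (hsepA : ∀ π τ : Equiv.Perm (Fin n), τ i ≠ j → (univ.filter fun x => π x = τ x).card < t →
      (A \ oneCoset i j).card < (cosetSeparating i j π τ).card)
    (hsepB : ∀ π τ : Equiv.Perm (Fin n), τ i ≠ j → (univ.filter fun x => π x = τ x).card < t →
      (B \ oneCoset i j).card < (cosetSeparating i j π τ).card)
    (hagree : ∀ π : Equiv.Perm (Fin n), (univ.filter fun τ : Equiv.Perm (Fin n) =>
      t ≤ (univ.filter fun x => π x = τ x).card).card ≤ numDerangements (n - 2)) :
    ∃ τ ρ : Equiv.Perm (Fin n), Intersects τ ρ ∧ τ i ≠ j ∧ ρ i ≠ j ∧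
      A = cosetMeeting i j τ ∪ {ρ} ∧ B = cosetMeeting i j ρ ∪ {τ} := by
  have hBA := hAB.symm
  have hA' := card_sdiff_oneCoset_le_numDerangements hBA hB hsepB hagree
  have hB' := card_sdiff_oneCoset_le_numDerangements hAB hA hsepA hagree
  obtain ⟨ρ, hρ⟩ := sdiff_oneCoset_nonempty hAB hA hnot
  obtain ⟨τ, hτ⟩ := sdiff_oneCoset_nonempty hBA hB fun h => hnot h.symm
  have eA : A \ oneCoset i j = {ρ} :=
    eq_singleton_iff_unique_mem.2 ⟨hρ, fun σ hσ => eq_of_mem_sdiff_oneCoset hBA hB hB' hσ hρ⟩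
  have eB : B \ oneCoset i j = {τ} :=
    eq_singleton_iff_unique_mem.2 ⟨hτ, fun σ hσ => eq_of_mem_sdiff_oneCoset hAB hA hA' hσ hτ⟩
  rw [mem_sdiff, mem_oneCoset] at hρ hτ
  exact ⟨τ, ρ, hBA τ hτ.1 ρ hρ.1, hτ.2, hρ.2, eq_cosetMeeting_union hAB hA eA hτ.1 hτ.2,
    eq_cosetMeeting_union hBA hB eB hρ.1 hρ.2⟩

theorem card_cosetMeeting_union_add {i j : Fin n} {τ ρ : Equiv.Perm (Fin n)} (hτ : τ i ≠ j)
    (hρ : ρ i ≠ j) :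
    (cosetMeeting i j τ ∪ {ρ}).card + (numDerangements (n - 1) + numDerangements (n - 2)) =
      (n - 1).factorial + 1 := by
  have h : Disjoint (cosetMeeting i j τ) {ρ} := by
    simp [cosetMeeting, hρ]
  have := card_cosetMeeting_add hτ
  rw [card_union_of_disjoint h, card_singleton]
  omega

theorem card_familyC_add (h2 : 2 ≤ n) :
    (familyC n h2).card + (numDerangements (n - 1) + numDerangements (n - 2)) =
      (n - 1).factorial + 1 :=
  card_cosetMeeting_union_add (by simp) (by simp)

end Extremal

/-! ### Numerical estimates. -/

section Estimates

theorem pow_mul_factorial_le (k d : ℕ) :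
    ((k + d : ℕ) : ℝ) ^ k * (d.factorial : ℝ) ≤ 3 ^ k * ((k + d).factorial : ℝ) := by
  induction k with
  | zero => simp
  | succ k ih =>
    have hstep : ((k + 1 + d : ℕ) : ℝ) ^ k ≤ 3 * ((k + d : ℕ) : ℝ) ^ k := by
      rcases Nat.eq_zero_or_pos (k + d) with h | h
      · obtain rfl : k = 0 := by omega
        simp
      have hpos : (0 : ℝ) < ((k + d : ℕ) : ℝ) := by exact_mod_cast h
      have hle : (1 + 1 / ((k + d : ℕ) : ℝ)) ^ k ≤ 3 := by
        have h1 : 1 + 1 / ((k + d : ℕ) : ℝ) ≤ Real.exp (1 / ((k + d : ℕ) : ℝ)) := by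
          rw [add_comm]
          exact Real.add_one_le_exp _
        calc (1 + 1 / ((k + d : ℕ) : ℝ)) ^ k ≤ Real.exp (1 / ((k + d : ℕ) : ℝ)) ^ k := by gcongr
          _ = Real.exp (k * (1 / ((k + d : ℕ) : ℝ))) := (Real.exp_nat_mul _ _).symm
          _ ≤ Real.exp 1 := by
              gcongr
              rw [mul_one_div, div_le_one hpos]
              exact_mod_cast Nat.le_add_right k d
          _ ≤ 3 := Real.exp_one_lt_three.le
      have heq : ((k + 1 + d : ℕ) : ℝ) = (1 + 1 / ((k + d : ℕ) : ℝ)) * ((k + d : ℕ) : ℝ) := by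
        field_simp
        push_cast
        ring
      rw [heq, mul_pow]
      gcongr
    have hfac : ((k + 1 + d).factorial : ℝ) = ((k + 1 + d : ℕ) : ℝ) * (k + d).factorial := by
      rw [show k + 1 + d = (k + d) + 1 by ring, Nat.factorial_succ]
      push_cast
      ring
    rw [hfac, pow_succ, pow_succ]
    calc ((k + 1 + d : ℕ) : ℝ) ^ k * ((k + 1 + d : ℕ) : ℝ) * d.factorial
        ≤ (3 * ((k + d : ℕ) : ℝ) ^ k) * ((k + 1 + d : ℕ) : ℝ) * d.factorial := by gcongr
      _ = 3 * ((k + 1 + d : ℕ) : ℝ) * (((k + d : ℕ) : ℝ) ^ k * d.factorial) := by ring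
      _ ≤ 3 * ((k + 1 + d : ℕ) : ℝ) * (3 ^ k * ((k + d).factorial : ℝ)) := by gcongr
      _ = _ := by ring

/-- The factor 3^k from `pow_mul_factorial_le` against 6^k leaves n!/2^k, and 2^k ≥ 100n. -/
theorem div_six_pow_mul_factorial_le {n q k : ℕ} (hn : 0 < n) (hq : 100 * n ≤ 2 ^ q) (hqk : q < k)
    (hkn : k ≤ n) :
    ((n : ℝ) / 6) ^ k * ((n - k).factorial : ℝ) ≤ ((n - 1).factorial : ℝ) / 100 := by
  have h := pow_mul_factorial_le k (n - k)
  rw [Nat.add_sub_cancel' hkn] at h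
  have h2 : (100 * n : ℝ) ≤ 2 ^ k := by
    have : (2 : ℕ) ^ q ≤ 2 ^ k := Nat.pow_le_pow_right (by norm_num) hqk.le
    exact_mod_cast hq.trans this
  have hfac : (n.factorial : ℝ) = n * (n - 1).factorial := by
    exact_mod_cast (Nat.mul_factorial_pred hn.ne').symm
  have h6 : (6 : ℝ) ^ k = 2 ^ k * 3 ^ k := by rw [← mul_pow]; norm_num
  rw [div_pow, div_mul_eq_mul_div, div_le_iff₀ (by positivity), h6]
  calc (n : ℝ) ^ k * ((n - k).factorial : ℝ) ≤ 3 ^ k * (n * (n - 1).factorial) := by rwa [← hfac]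
    _ = ((n - 1).factorial : ℝ) / 100 * ((100 * n) * 3 ^ k) := by ring
    _ ≤ _ := by gcongr

theorem one_add_div_pow_le_exp (a : ℝ) (ha : 0 ≤ a) {n : ℕ} (hn : 0 < n) (k : ℕ) :
    (1 + a * ((n : ℝ) / 6)⁻¹) ^ k ≤ Real.exp (6 * a * k / n) := by
  have h1 : 1 + a * ((n : ℝ) / 6)⁻¹ ≤ Real.exp (a * ((n : ℝ) / 6)⁻¹) := by
    rw [add_comm]
    exact Real.add_one_le_exp _
  calc _ ≤ Real.exp (a * ((n : ℝ) / 6)⁻¹) ^ k := by gcongr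
    _ = Real.exp (k * (a * ((n : ℝ) / 6)⁻¹)) := (Real.exp_nat_mul _ _).symm
    _ = _ := by
      congr 1
      field_simp

theorem exists_core_size {n : ℕ} (hn : 2 ^ 12 ≤ n) : ∃ q, 100 * n ≤ 2 ^ q ∧ 10 * q ^ 2 ≤ n - 1 := by
  have hpow : ∀ l, 12 ≤ l → 10 * (l + 8) ^ 2 + 1 ≤ 2 ^ l := by
    intro l hl
    induction l, hl using Nat.le_induction with
    | base => norm_num
    | succ l hl ih =>
      have h2 : 2 ^ (l + 1) = 2 * 2 ^ l := by ring
      nlinarith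
  have hl : 12 ≤ Nat.log 2 n := Nat.le_log_of_pow_le (by norm_num) hn
  have h1 : n < 2 ^ (Nat.log 2 n + 1) := Nat.lt_pow_succ_log_self (by norm_num) n
  have h2 : 2 ^ Nat.log 2 n ≤ n := Nat.pow_log_le_self 2 (by omega)
  have h3 := hpow _ hl
  refine ⟨Nat.log 2 n + 8, ?_, by omega⟩
  rw [pow_add] at h1 ⊢
  omega

theorem sq_le_factorial_div_ten {n : ℕ} (hn : 80 ≤ n) : 3 * n * (n - 1) ≤ (n / 10).factorial := by
  have hfac : ∀ t, 8 ≤ t → 300 * (t + 1) ^ 2 ≤ t.factorial := by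
    intro t ht
    induction t, ht using Nat.le_induction with
    | base => decide
    | succ t ht ih =>
      rw [Nat.factorial_succ]
      nlinarith
  have h := hfac (n / 10) (by omega)
  have h1 : n ≤ 10 * (n / 10 + 1) := by omega
  calc 3 * n * (n - 1) ≤ 3 * n * n := Nat.mul_le_mul_left _ (Nat.sub_le _ _)
    _ ≤ 3 * (10 * (n / 10 + 1)) * (10 * (n / 10 + 1)) := by gcongr
    _ = 300 * (n / 10 + 1) ^ 2 := by ring
    _ ≤ _ := h

theorem eventually_numDerangements_bounds : ∃ M : ℕ, ∀ m, M ≤ m →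
    (m.factorial : ℝ) ≤ 3 * numDerangements m ∧
      (numDerangements m : ℝ) ≤ 2 / 5 * m.factorial := by
  have h := numDerangements_tendsto_inv_e
  have he : Real.exp (-1) = (Real.exp 1)⁻¹ := Real.exp_neg 1
  have hlo : 1 / 3 < Real.exp (-1) := by
    rw [he, one_div]
    exact inv_strictAnti₀ (Real.exp_pos 1) Real.exp_one_lt_three
  have hhi : Real.exp (-1) < 2 / 5 := by
    rw [he, inv_lt_comm₀ (Real.exp_pos 1) (by norm_num)]
    have := Real.exp_one_gt_d9
    norm_num
    linarith
  have hev := (h.eventually (lt_mem_nhds hlo)).and (h.eventually (gt_mem_nhds hhi))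
  obtain ⟨M, hM⟩ := Filter.eventually_atTop.1 hev
  refine ⟨M, fun m hm => ?_⟩
  obtain ⟨h1, h2⟩ := hM m hm
  have hpos : (0 : ℝ) < m.factorial := by exact_mod_cast m.factorial_pos
  rw [lt_div_iff₀ hpos] at h1
  rw [div_lt_iff₀ hpos] at h2
  exact ⟨by linarith, h2.le⟩

end Estimates

/-! ### Choice of parameters and conclusion. -/

/-- The extremal form holds for all sufficiently large `n`. -/
theorem exists_extremal_form : ∃ N : ℕ, ∀ n, N ≤ n → ∀ A B : Finset (Equiv.Perm (Fin n)),
    CrossIntersecting A B → (¬ ∃ i j : Fin n, A ⊆ oneCoset i j ∧ B ⊆ oneCoset i j) →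
    (n - 1).factorial + 1 ≤ A.card + (numDerangements (n - 1) + numDerangements (n - 2)) →
    (n - 1).factorial + 1 ≤ B.card + (numDerangements (n - 1) + numDerangements (n - 2)) →
    ∃ (i j : Fin n) (τ ρ : Equiv.Perm (Fin n)), Intersects τ ρ ∧ τ i ≠ j ∧ ρ i ≠ j ∧
      A = cosetMeeting i j τ ∪ {ρ} ∧ B = cosetMeeting i j ρ ∪ {τ} := by
  obtain ⟨M, hM⟩ := eventually_numDerangements_bounds
  refine ⟨M + 100000, fun n hn A B hAB hnot hA hB => ?_⟩
  obtain ⟨q, hq1, hq2⟩ := exists_core_size (n := n) (by norm_num; omega)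
  obtain ⟨hd2, -⟩ := hM (n - 2) (by omega)
  obtain ⟨-, hd1⟩ := hM (n - 1) (by omega)
  obtain ⟨-, hd2'⟩ := hM (n - 2) (by omega)
  have hnR : (100000 : ℝ) ≤ n := by exact_mod_cast (by omega : 100000 ≤ n)
  have hf1 : ((n - 1).factorial : ℝ) = (n - 1) * (n - 2).factorial := by
    have h := Nat.mul_factorial_pred (n := n - 1) (by omega)
    rw [show n - 1 - 1 = n - 2 by omega] at h
    rw [← h]
    push_cast [Nat.cast_sub (show 1 ≤ n by omega)]
    ring
  have hf2 : ((n - 2).factorial : ℝ) = (n - 2) * (n - 3).factorial := by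
    have h := Nat.mul_factorial_pred (n := n - 2) (by omega)
    rw [show n - 2 - 1 = n - 3 by omega] at h
    rw [← h]
    push_cast [Nat.cast_sub (show 2 ≤ n by omega)]
    ring
  have hq2R : 10 * (q : ℝ) ^ 2 ≤ n - 1 := by
    have : 10 * q ^ 2 + 1 ≤ n := by omega
    have : (10 * (q : ℝ) ^ 2 + 1) ≤ n := by exact_mod_cast this
    linarith
  set f : ℝ := ((n - 2).factorial : ℝ) with hf
  have hfpos : 0 < f := by
    rw [hf]
    exact_mod_cast (n - 2).factorial_pos
  have hlarge : ∀ D : Finset (Equiv.Perm (Fin n)),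
      (n - 1).factorial + 1 ≤ D.card + (numDerangements (n - 1) + numDerangements (n - 2)) →
      (q : ℝ) ^ 2 * f + ((n - 1).factorial : ℝ) / 100 < D.card := by
    intro D hD
    have hD' : ((n - 1).factorial : ℝ) + 1 ≤
        D.card + (numDerangements (n - 1) + numDerangements (n - 2)) := by exact_mod_cast hD
    have h1 : 10 * (q : ℝ) ^ 2 * f ≤ (n - 1) * f := by gcongr
    have h2 : 100 * f ≤ (n - 1) * f := by
      gcongr
      linarith
    rw [hf1] at hd1 hD' ⊢
    linarith
  -- The left side is at most 16·e^36 ≤ 16·3^36, which is why m = 64 suffices.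
  have h1 : 16 * (1 + 6 * ((n : ℝ) / 6)⁻¹) ^ n ≤ 2 ^ 64 := by
    have h := one_add_div_pow_le_exp 6 (by norm_num) (n := n) (by omega) n
    have h36 : (6 * 6 * n / n : ℝ) = ((36 : ℕ) : ℝ) * 1 := by
      field_simp
      norm_num
    rw [h36, Real.exp_nat_mul] at h
    have h3 : Real.exp 1 ^ 36 ≤ 3 ^ 36 := by
      gcongr
      exact Real.exp_one_lt_three.le
    norm_num at h h3 ⊢
    linarith
  -- The exponent is 49152/n, at most 1/2 once n ≥ 98304; this dictates the size of the threshold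
  -- 100000.
  have h2 : (1 + 128 * ((n : ℝ) / 6)⁻¹) ^ 64 ≤ 2 := by
    have h := one_add_div_pow_le_exp 128 (by norm_num) (n := n) (by omega) 64
    refine h.trans ?_
    have h3 : Real.exp (6 * 128 * (64 : ℕ) / n) ≤ Real.exp (1 / 2) := by
      rw [Real.exp_le_exp, div_le_div_iff₀ (by linarith) (by norm_num)]
      norm_num
      linarith
    refine h3.trans ?_
    have h4 : Real.exp (1 / 2) ^ 2 = Real.exp 1 := by
      rw [← Real.exp_nat_mul]
      norm_num
    have h5 := Real.exp_one_lt_three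
    exact le_of_sq_le_sq (by linarith) (by norm_num)
  have h3 : (2 * q : ℝ) ≤ (n : ℝ) / 6 := by
    have : q ≤ n / 12 := by
      rw [Nat.le_div_iff_mul_le (by norm_num)]
      by_contra hlt
      push Not at hlt
      have hq : 100 ≤ q := by omega
      nlinarith [Nat.sub_le n 1]
    have h12 : q * 12 ≤ n := by omega
    have : (q * 12 : ℝ) ≤ n := by exact_mod_cast h12
    linarith
  obtain ⟨i, j, hAij, hBij⟩ := exists_oneCoset_almost_containing hAB (by omega)
    (r := (n : ℝ) / 6) (E := ((n - 1).factorial : ℝ) / 100) (q := q) (m := 64)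
    (by linarith) h3 h1 h2 (by positivity)
    (fun k hk hkn => div_six_pow_mul_factorial_le (by omega) hq1 hk hkn) (hlarge A hA) (hlarge B hB)
  -- With about 9n/10 free points and d_{n-2} ≥ (n-2)!/3, the second-moment bound is roughly (1/10 −
  -- 2.1/36)·n·(n-2)!, well above (n-1)!/100.
  have hsep : ∀ π τ : Equiv.Perm (Fin n), τ i ≠ j →
      (univ.filter fun x => π x = τ x).card < n / 10 →
      ((n - 1).factorial : ℝ) / 100 < (cosetSeparating i j π τ).card := by
    intro π τ hτ hlt
    refine lt_of_lt_of_le ?_ (card_cosetSeparating_ge hτ)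
    have hfree := card_freePoints_ge i j π τ
    have hfree' : 9 * n ≤ 10 * (freePoints i j π τ).card + 20 := by omega
    have hfreeR : (9 * n : ℝ) ≤ 10 * (freePoints i j π τ).card + 20 := by exact_mod_cast hfree'
    have e1 : (9 * n / 10 - 2 : ℝ) * (f / 3) ≤
        (freePoints i j π τ).card * numDerangements (n - 2) := by
      gcongr
      · linarith
      · linarith
    have e2 : (n : ℝ) ^ 2 * ((n - 3).factorial : ℝ) ≤ 11 / 10 * n * f := by
      rw [hf2]
      have : (n : ℝ) ^ 2 ≤ 11 / 10 * n * (n - 2) := by nlinarith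
      calc _ ≤ (11 / 10 * n * (n - 2) : ℝ) * ((n - 3).factorial : ℝ) := by gcongr
        _ = _ := by ring
    have e3 : 100000 * f ≤ n * f := by gcongr
    rw [hf1]
    linarith
  obtain ⟨τ, ρ, h⟩ := extremal_form hAB (i := i) (j := j) (t := n / 10)
    (fun h => hnot ⟨i, j, h⟩) hA hB
    (fun π τ hτ hlt => by exact_mod_cast hAij.trans_lt (hsep π τ hτ hlt))
    (fun π τ hτ hlt => by exact_mod_cast hBij.trans_lt (hsep π τ hτ hlt))
    (fun π => by
      have h := card_agree_mul_factorial_le π (t := n / 10) (Nat.div_le_self _ _)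
      have h3 := sq_le_factorial_div_ten (n := n) (by omega)
      have hfac : n.factorial = n * (n - 1) * (n - 2).factorial := by
        rw [← Nat.mul_factorial_pred (n := n) (by omega),
          ← Nat.mul_factorial_pred (n := n - 1) (by omega), mul_assoc]
        rfl
      have hd : (n - 2).factorial ≤ 3 * numDerangements (n - 2) := by
        rw [hf] at hd2
        exact_mod_cast hd2
      refine Nat.le_of_mul_le_mul_right (h.trans ?_) (Nat.factorial_pos (n / 10))
      calc n.factorial ≤ n * (n - 1) * (3 * numDerangements (n - 2)) := by
            rw [hfac]
            gcongr
        _ = numDerangements (n - 2) * (3 * n * (n - 1)) := by ring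
        _ ≤ _ := by gcongr)
  exact ⟨i, j, τ, ρ, h⟩

end CrossInt

theorem mainTheorem7 :
    ∃ N : ℕ, ∀ (n : ℕ) (h2 : 2 ≤ n), N ≤ n →
      ((CrossInt.familyC n h2).card : ℤ) =
        (Nat.factorial (n - 1) : ℤ) - (numDerangements (n - 1) : ℤ)
          - (numDerangements (n - 2) : ℤ) + 1 ∧
      ∀ A B : Finset (Equiv.Perm (Fin n)),
        CrossInt.CrossIntersecting A B →
        (¬ ∃ i j : Fin n, A ⊆ CrossInt.oneCoset i j ∧ B ⊆ CrossInt.oneCoset i j) →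
        min A.card B.card ≤ (CrossInt.familyC n h2).card ∧
        (min A.card B.card = (CrossInt.familyC n h2).card ↔
          ∃ (i j : Fin n) (τ ρ : Equiv.Perm (Fin n)),
            CrossInt.Intersects τ ρ ∧ τ i ≠ j ∧ ρ i ≠ j ∧
            A = CrossInt.cosetMeeting i j τ ∪ {ρ} ∧
            B = CrossInt.cosetMeeting i j ρ ∪ {τ}) := by
  obtain ⟨N, hN⟩ := CrossInt.exists_extremal_form
  refine ⟨N, fun n h2 hn => ?_⟩
  have hC := CrossInt.card_familyC_add h2
  refine ⟨by omega, fun A B hAB hnot => ?_⟩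
  have hform := hN n hn A B hAB hnot
  have hcard : (∃ (i j : Fin n) (τ ρ : Equiv.Perm (Fin n)),
      CrossInt.Intersects τ ρ ∧ τ i ≠ j ∧ ρ i ≠ j ∧
      A = CrossInt.cosetMeeting i j τ ∪ {ρ} ∧ B = CrossInt.cosetMeeting i j ρ ∪ {τ}) →
      min A.card B.card = (CrossInt.familyC n h2).card := by
    rintro ⟨i, j, τ, ρ, -, hτ, hρ, rfl, rfl⟩
    have e1 := CrossInt.card_cosetMeeting_union_add hτ hρ
    have e2 := CrossInt.card_cosetMeeting_union_add hρ hτ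
    omega
  -- The upper bound follows from the same structure result: if both families exceeded |C|, they
  -- would be extremal and the minimum would equal |C|.
  refine ⟨?_, fun heq => hform (by omega) (by omega), hcard⟩
  by_contra! hlt
  have := hcard (hform (by omega) (by omega))
  omega
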